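/- A *digraph* is finite and has no loops or multiple edges. For a digraph $G$ and $X\subseteq V(G)$, $\mathrm{Reach}_G(X)$ is the set of vertices reachable from $X$. A *DAG decomposition* of $G$ is a finite directed acyclic graph $D$ with a bag $B_d\subseteq V(G)$ for each node $d$ such that, where $\le$ is the reachability order of $D$ and $B_{\ge a}=\bigcup_{a\le d}B_d$: (1) $\bigcup_d B_d=V(G)$; (2) $a<b<c$ implies $B_a\cap B_c\subseteq B_b$; (3) $\mathrm{Reach}_G(B_{\ge r})=B_{\ge r}$ for every root (source) $r$ of $D$; (4) $\mathrm{Reach}_{G-(B_a\cap B_b)}(B_{\ge b}\setminus B_a)=B_{\ge b}\setminus B_a$ for every edge $(a,b)$ of $D$. Its *width* is $\max_d|B_d|$, and the *DAG-width* of $G$ is the minimal width of a DAG decomposition of $G$. The number of bags is the number $|\{B_d : d\in V(D)\}|$ of distinct bags; it is at most the number $|V(D)|$ of nodes. Let $s,t\colon\mathbb N\to\mathbb N$ satisfy $2\le s(n)<n/\ln n$ and $2\le t(n)$ for all $n\ge 5$. (If $s(n)<n/\log_2 n$, then also $s(n)<n/\ln n$.) Define $G_n=G_n(s,t)$ recursively.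 For $n\le 4$, $G_n$ is a single vertex. For $n\ge5$, put $n'=n-s(n)-1$ and take new pairwise disjoint sets $M$, $D$, $A$, $B=\{b_0,\dots,b_{t(n)-1}\}$ and $C_0,\dots,C_{t(n)-1}$ with $|M|=|C_i|=n-s(n)$, $|D|=|A|=s(n)$, $|B|=t(n)$. Let $N=M\cup D$. Then $V(G_n)$ is the disjoint union of $V(G_{n'})$, $A$, $B$, all the $C_i$, and $N$. The edges are those of $G_{n'}$, all pairs of distinct vertices inside $N$, inside $A$ and inside each $C_i$, and the sets $$N\times C_i,\quad C_i\times D,\quad C_i\times\{b_i\}\quad(0\le i<t(n)),$$ $$B\times A,\quad A\times B,\quad A\times M,\quad N\times V(G_{n'}),\quad A\times V(G_{n'}),\quad V(G_{n'})\times A,\quad V(G_{n'})\times B.$$ Let $L(n)$ be the set of *levels* of $G_n$: $L(n)=\emptyset$ for $n\le4$ and $L(n)=\{n\}\cup L(n-s(n)-1)$ for $n\ge5$. Write $|G_n|=|V(G_n)|$. **Theorem.** (a) For every $n\ge5$ the DAG-width of $G_n$ is $n+1$. (b) If $t$ is monotone (non-decreasing or non-increasing) on $\{5,6,\dots\}$,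 then $|G_n|=O(n^2\,t(n))$ as $n\to\infty$. (c) For every $n\ge5$, every DAG decomposition of $G_n$ of (optimal) width $n+1$ has at least $\prod_{\ell\in L(n)}t(\ell)$ bags. (d) For every $n\ge64$, every DAG decomposition of $G_n$ of width $n+1$ has at least $\tau^{\log_2 n}$ bags, where $\tau=\min_{\ell\in L(n)}t(\ell)$. (e) Suppose that $t$ is polynomially bounded: $t(n)\le n^k$ for some $k$ and all sufficiently large $n$ (for instance, $t$ is non-increasing, or $t(n)\le n$). Then the number of bags is super-polynomial in $|G_n|$: for every $c$ there is $n_0$ such that for all $n\ge n_0$ every DAG decomposition of $G_n$ of width $n+1$ has more than $|G_n|^c$ bags. -/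

import Mathlib

open Filter

namespace DagWidth

/-! ## DAG decompositions and DAG-width of a finite digraph -/

/-- `reach G S X` is the set of vertices that are reachable in `G - S` from some vertex of `X`
(paths of length `0` are allowed, and only vertices outside `S` exist in `G - S`). -/
def reach {V : Type*} (G : Digraph V) (S X : Set V) : Set V :=
  {v | ∃ u ∈ X, u ∉ S ∧ Relation.ReflTransGen (fun x y => G.Adj x y ∧ x ∉ S ∧ y ∉ S) u v}

/-- `Below D B a` is the union of the bags `B d` over all nodes `d` with `a ≤ d`, that is, over all
nodes `d` that are reachable from `a` in `D`. -/
def Below {V I : Type*} (D : Digraph I) (B : I → Finset V) (a : I) : Set V :=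
  {v | ∃ d, Relation.ReflTransGen D.Adj a d ∧ v ∈ B d}

/-- A DAG decomposition of the digraph `G`: a finite DAG together with a bag for each node. -/
structure DAGDecomposition {V : Type} (G : Digraph V) where
  /-- the nodes of the DAG -/
  Node : Type
  /-- there are finitely many nodes -/
  [fintypeNode : Fintype Node]
  /-- the edges of the DAG -/
  dag : Digraph Node
  /-- the bags -/
  bag : Node → Finset V
  acyclic : ∀ d, ¬ Relation.TransGen dag.Adj d d
  /-- every vertex lies in some bag -/
  cover : ∀ v, ∃ d, v ∈ bag d
  /-- if `a < b < c` then `bag a ∩ bag c ⊆ bag b` -/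
  connected : ∀ a b c, Relation.TransGen dag.Adj a b → Relation.TransGen dag.Adj b c →
    ∀ v, v ∈ bag a → v ∈ bag c → v ∈ bag b
  /-- the vertices below a root (a node without incoming edges) are closed under reachability -/
  root_closed : ∀ r, (∀ a, ¬ dag.Adj a r) →
    reach G ∅ (Below dag bag r) = Below dag bag r
  /-- for every edge `(a, b)`, the vertices below `b` that are not in `bag a` are closed under
  reachability in `G - (bag a ∩ bag b)` -/
  edge_guarded : ∀ a b, dag.Adj a b →
    reach G ((bag a : Set V) ∩ bag b) (Below dag bag b \ bag a) = Below dag bag b \ bag a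

attribute [instance] DAGDecomposition.fintypeNode

/-- The width: the largest cardinality of a bag. -/
def DAGDecomposition.width {V : Type} {G : Digraph V} (𝒟 : DAGDecomposition G) : ℕ :=
  Finset.univ.sup fun d => (𝒟.bag d).card

/-- The number of bags, where equal bags at different nodes are counted once. This is at most the
number of nodes of the DAG. -/
noncomputable def DAGDecomposition.numBags {V : Type} {G : Digraph V}
    (𝒟 : DAGDecomposition G) : ℕ :=
  (Set.range 𝒟.bag).ncard

/-- The number of bags is at most the number of nodes. -/
theorem DAGDecomposition.numBags_le {V : Type} {G : Digraph V} (𝒟 : DAGDecomposition G) :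
    𝒟.numBags ≤ Fintype.card 𝒟.Node := by
  unfold DAGDecomposition.numBags
  rw [← Set.image_univ]
  refine (Set.ncard_image_le Set.finite_univ).trans ?_
  rw [Set.ncard_univ, Nat.card_eq_fintype_card]

/-- The DAG-width: the minimal width of a DAG decomposition. -/
noncomputable def dagWidth {V : Type} (G : Digraph V) : ℕ :=
  sInf {w | ∃ 𝒟 : DAGDecomposition G, 𝒟.width = w}

/-! ## The graphs `G_n(s,t)` -/

/-- Names for vertices. The argument `ℓ` is the level. -/
inductive Vtx : Type
  | bot : Vtx
  | m (ℓ k : ℕ) : Vtx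
  | d (ℓ k : ℕ) : Vtx
  | c (ℓ i k : ℕ) : Vtx
  | a (ℓ k : ℕ) : Vtx
  | b (ℓ i : ℕ) : Vtx
  deriving DecidableEq

/-- `M(n)`, with `n - s(n)` elements. -/
def setM (s : ℕ → ℕ) (n : ℕ) : Finset Vtx := (Finset.range (n - s n)).image (Vtx.m n)

/-- `D^s(n)`, with `s(n)` elements. -/
def setD (s : ℕ → ℕ) (n : ℕ) : Finset Vtx := (Finset.range (s n)).image (Vtx.d n)

/-- `N(n) = M(n) ∪ D^s(n)`. -/
def setN (s : ℕ → ℕ) (n : ℕ) : Finset Vtx := setM s n ∪ setD s n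

/-- `C_i(n)`, with `n - s(n)` elements. -/
def setC (s : ℕ → ℕ) (n i : ℕ) : Finset Vtx := (Finset.range (n - s n)).image (Vtx.c n i)

/-- `A^s(n)`, with `s(n)` elements. -/
def setA (s : ℕ → ℕ) (n : ℕ) : Finset Vtx := (Finset.range (s n)).image (Vtx.a n)

/-- `B^t(n) = {b_0(n), …, b_{t(n)-1}(n)}`. -/
def setB (t : ℕ → ℕ) (n : ℕ) : Finset Vtx := (Finset.range (t n)).image (Vtx.b n)

/-- The vertex set of `G_n(s,t)`. -/
def verts (s t : ℕ → ℕ) (n : ℕ) : Finset Vtx :=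
  if n < 5 then {Vtx.bot}
  else verts s t (n - s n - 1) ∪ setA s n ∪ setB t n ∪
    (Finset.range (t n)).biUnion (setC s n) ∪ setN s n
termination_by n
decreasing_by omega

/-- The edge set of `G_n(s,t)`; `X.offDiag` is the set of all pairs of distinct elements of `X`. -/
def edges (s t : ℕ → ℕ) (n : ℕ) : Finset (Vtx × Vtx) :=
  if n < 5 then ∅
  else edges s t (n - s n - 1)
    ∪ (setN s n).offDiag
    ∪ (Finset.range (t n)).biUnion (fun i => (setC s n i).offDiag)
    ∪ (setA s n).offDiag
    ∪ (Finset.range (t n)).biUnion (fun i =>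
        setN s n ×ˢ setC s n i ∪ setC s n i ×ˢ setD s n ∪ setC s n i ×ˢ {Vtx.b n i})
    ∪ setB t n ×ˢ setA s n
    ∪ setA s n ×ˢ setB t n
    ∪ setA s n ×ˢ setM s n
    ∪ setN s n ×ˢ verts s t (n - s n - 1)
    ∪ setA s n ×ˢ verts s t (n - s n - 1)
    ∪ verts s t (n - s n - 1) ×ˢ setA s n
    ∪ verts s t (n - s n - 1) ×ˢ setB t n
termination_by n
decreasing_by omega

/-- The graph `G_n(s,t)`. -/
def graph (s t : ℕ → ℕ) (n : ℕ) : Digraph {v // v ∈ verts s t n} where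
  Adj x y := (x.1, y.1) ∈ edges s t n

/-- The levels of `G_n(s,t)`: the indices `n, n - s(n) - 1, …` that are at least `5` and occur in
the recursive construction. -/
def levels (s : ℕ → ℕ) (n : ℕ) : Finset ℕ :=
  if n < 5 then ∅ else insert n (levels s (n - s n - 1))
termination_by n
decreasing_by omega

end DagWidth

namespace DagWidth


/-! A DAG decomposition is a strategy of cops against a visible robber: going down an edge moves the
cops from one bag to the next, and the guarding conditions keep the robber's territory from growing.
Hence a cop on a vertex that the robber can reach has to stay.

Lower bound: let all of `G_n` see a guard `Z`, with `n + 1` cops to spare. The robber waits in the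
clique `N` until it is occupied, which leaves one free cop. For any `i` he then moves to `C_i`,
unless `b_i` is occupied already. While `b_i` is free, the paths `C_i → b_i → A → M` and the edges
`C_i → D` show him all of `N`, and the free cop cannot fill `C_i`. Since the DAG is finite, some bag
must be `Z ∪ N ∪ {b_i}`, and the robber slips through `A` into `G_{n'}` (`exists_bag_eq`). From
there he sees `b_i`, and also `M` as long as `A` is not full, so the cops have to fill `A`
(`exists_pos_setN`). Now `A ∪ {b_i}` joins the guard and `n' + 1` cops remain for `G_{n'}`. By
induction every choice of one index per level is realised by a bag of size `n + 1` that meets each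
`B(ℓ)` in the chosen vertex only (`exists_bag_of_choice`). Different choices give different bags,
which yields the product bound, and the size gives the width.

Upper bound: the cops win along the same course. They take `N`, then `b_i` for the one `C_i` open to
the robber, then either `C_i` or `A`, and recurse (`win_verts`). Such a strategy unfolds into a
tree-shaped decomposition (`Win.exists_dagDecomposition`).

Counting: since `s(n) < n / log n`, the number of levels is at least `log₂ n` for `n ≥ 64` and
eventually exceeds every multiple of it, while `|G_n|` is polynomial when `t` is. -/

/-- The level of a vertex name. -/
def Vtx.level : Vtx → ℕ
  | .bot => 0
  | .m ℓ _ => ℓ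
  | .d ℓ _ => ℓ
  | .c ℓ _ _ => ℓ
  | .a ℓ _ => ℓ
  | .b ℓ _ => ℓ

/-! ### Vertices, edges and levels of `G_n` -/

section Membership

variable {s t : ℕ → ℕ} {n : ℕ}

lemma mem_setM {v : Vtx} : v ∈ setM s n ↔ ∃ k < n - s n, Vtx.m n k = v := by simp [setM]

lemma mem_setD {v : Vtx} : v ∈ setD s n ↔ ∃ k < s n, Vtx.d n k = v := by simp [setD]

lemma mem_setA {v : Vtx} : v ∈ setA s n ↔ ∃ k < s n, Vtx.a n k = v := by simp [setA]

lemma mem_setB {v : Vtx} : v ∈ setB t n ↔ ∃ i < t n, Vtx.b n i = v := by simp [setB]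

lemma mem_setC {i : ℕ} {v : Vtx} : v ∈ setC s n i ↔ ∃ k < n - s n, Vtx.c n i k = v := by
  simp [setC]

lemma mem_setN {v : Vtx} : v ∈ setN s n ↔ v ∈ setM s n ∨ v ∈ setD s n := by simp [setN]

lemma card_setM : (setM s n).card = n - s n := by
  rw [setM, Finset.card_image_of_injective _ (fun _ _ h => by simpa using h), Finset.card_range]

lemma card_setD : (setD s n).card = s n := by
  rw [setD, Finset.card_image_of_injective _ (fun _ _ h => by simpa using h), Finset.card_range]

lemma card_setA : (setA s n).card = s n := by
  rw [setA, Finset.card_image_of_injective _ (fun _ _ h => by simpa using h), Finset.card_range]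

lemma card_setB : (setB t n).card = t n := by
  rw [setB, Finset.card_image_of_injective _ (fun _ _ h => by simpa using h), Finset.card_range]

lemma card_setC {i : ℕ} : (setC s n i).card = n - s n := by
  rw [setC, Finset.card_image_of_injective _ (fun _ _ h => by simpa using h), Finset.card_range]

lemma disjoint_setM_setD : Disjoint (setM s n) (setD s n) := by
  rw [Finset.disjoint_left]
  intro v h h'
  obtain ⟨_, _, rfl⟩ := mem_setM.1 h
  obtain ⟨_, _, h⟩ := mem_setD.1 h'
  cases h

lemma card_setN (h : s n ≤ n) : (setN s n).card = n := by
  rw [setN, Finset.card_union_of_disjoint disjoint_setM_setD, card_setM, card_setD]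
  omega

lemma verts_of_lt (h : n < 5) : verts s t n = {Vtx.bot} := by
  rw [verts, if_pos h]

lemma edges_of_lt (h : n < 5) : edges s t n = ∅ := by
  rw [edges, if_pos h]

lemma levels_of_lt (h : n < 5) : levels s n = ∅ := by
  rw [levels, if_pos h]

lemma levels_of_le (h : 5 ≤ n) : levels s n = insert n (levels s (n - s n - 1)) := by
  rw [levels, if_neg (by omega)]

lemma mem_verts (h : 5 ≤ n) {v : Vtx} :
    v ∈ verts s t n ↔ v ∈ verts s t (n - s n - 1) ∨ v ∈ setA s n ∨ v ∈ setB t n ∨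
      (∃ i < t n, v ∈ setC s n i) ∨ v ∈ setN s n := by
  rw [verts, if_neg (by omega)]
  simp only [Finset.mem_union, Finset.mem_biUnion, Finset.mem_range, or_assoc]

lemma mem_edges (h : 5 ≤ n) {u v : Vtx} :
    (u, v) ∈ edges s t n ↔ (u, v) ∈ edges s t (n - s n - 1) ∨
      (u ∈ setN s n ∧ v ∈ setN s n ∧ u ≠ v) ∨
      (∃ i < t n, u ∈ setC s n i ∧ v ∈ setC s n i ∧ u ≠ v) ∨
      (u ∈ setA s n ∧ v ∈ setA s n ∧ u ≠ v) ∨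
      (∃ i < t n, u ∈ setN s n ∧ v ∈ setC s n i ∨ u ∈ setC s n i ∧ v ∈ setD s n ∨
        u ∈ setC s n i ∧ v = Vtx.b n i) ∨
      (u ∈ setB t n ∧ v ∈ setA s n) ∨ (u ∈ setA s n ∧ v ∈ setB t n) ∨
      (u ∈ setA s n ∧ v ∈ setM s n) ∨ (u ∈ setN s n ∧ v ∈ verts s t (n - s n - 1)) ∨
      (u ∈ setA s n ∧ v ∈ verts s t (n - s n - 1)) ∨
      (u ∈ verts s t (n - s n - 1) ∧ v ∈ setA s n) ∨
      (u ∈ verts s t (n - s n - 1) ∧ v ∈ setB t n) := by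
  rw [edges, if_neg (by omega)]
  simp only [Finset.mem_union, Finset.mem_biUnion, Finset.mem_range, Finset.mem_offDiag,
    Finset.mem_product, Finset.mem_singleton, or_assoc]

lemma level_le_of_mem_verts : ∀ {n : ℕ} {v : Vtx}, v ∈ verts s t n → v.level ≤ n := by
  intro n
  induction n using Nat.strong_induction_on with
  | _ n ih =>
    intro v hv
    rcases lt_or_ge n 5 with h | h
    · rw [verts_of_lt h, Finset.mem_singleton] at hv
      subst hv
      exact Nat.zero_le _
    · rcases (mem_verts h).1 hv with hv | hv | hv | ⟨i, -, hv⟩ | hv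
      · exact (ih _ (by omega) hv).trans (by omega)
      · obtain ⟨_, _, rfl⟩ := mem_setA.1 hv; exact le_rfl
      · obtain ⟨_, _, rfl⟩ := mem_setB.1 hv; exact le_rfl
      · obtain ⟨_, _, rfl⟩ := mem_setC.1 hv; exact le_rfl
      · rcases mem_setN.1 hv with hv | hv
        · obtain ⟨_, _, rfl⟩ := mem_setM.1 hv; exact le_rfl
        · obtain ⟨_, _, rfl⟩ := mem_setD.1 hv; exact le_rfl

/-- The parts of `G_n` that are added at level `n`. -/
inductive Part : Type
  | m | d | c (i : ℕ) | a | b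

/-- The vertex set of a part. -/
def Part.toFinset (s t : ℕ → ℕ) (n : ℕ) : Part → Finset Vtx
  | .m => setM s n
  | .d => setD s n
  | .c i => setC s n i
  | .a => setA s n
  | .b => setB t n

/-- The part that a vertex name belongs to, if any. -/
def Vtx.part : Vtx → Option Part
  | .bot => none
  | .m _ _ => some .m
  | .d _ _ => some .d
  | .c _ i _ => some (.c i)
  | .a _ _ => some .a
  | .b _ _ => some .b

lemma Part.level_eq {p : Part} {v : Vtx} (h : v ∈ p.toFinset s t n) :
    v.level = n ∧ v.part = some p := by
  cases p
  · obtain ⟨_, _, rfl⟩ := mem_setM.1 h; exact ⟨rfl, rfl⟩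
  · obtain ⟨_, _, rfl⟩ := mem_setD.1 h; exact ⟨rfl, rfl⟩
  · obtain ⟨_, _, rfl⟩ := mem_setC.1 h; exact ⟨rfl, rfl⟩
  · obtain ⟨_, _, rfl⟩ := mem_setA.1 h; exact ⟨rfl, rfl⟩
  · obtain ⟨_, _, rfl⟩ := mem_setB.1 h; exact ⟨rfl, rfl⟩

lemma Part.eq_of_mem {p q : Part} {v : Vtx} (hp : v ∈ p.toFinset s t n)
    (hq : v ∈ q.toFinset s t n) : p = q :=
  Option.some.inj ((Part.level_eq hp).2.symm.trans (Part.level_eq hq).2)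

lemma Part.notMem_verts (h : 5 ≤ n) {p : Part} {v : Vtx} (hp : v ∈ p.toFinset s t n) :
    v ∉ verts s t (n - s n - 1) := by
  intro hv
  have h1 := level_le_of_mem_verts hv
  have h2 := (Part.level_eq hp).1
  omega

lemma mem_verts_of_mem_edges : ∀ {n : ℕ} {u v : Vtx}, (u, v) ∈ edges s t n →
    u ∈ verts s t n ∧ v ∈ verts s t n := by
  intro n
  induction n using Nat.strong_induction_on with
  | _ n ih =>
    intro u v huv
    rcases lt_or_ge n 5 with h | h
    · rw [edges_of_lt h] at huv
      simp at huv
    · rw [mem_verts h, mem_verts h]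
      rw [mem_edges h] at huv
      have hb : ∀ i < t n, Vtx.b n i ∈ setB t n := fun i hi => mem_setB.2 ⟨i, hi, rfl⟩
      have hM : ∀ x ∈ setM s n, x ∈ setN s n := fun x hx => mem_setN.2 (Or.inl hx)
      have hD : ∀ x ∈ setD s n, x ∈ setN s n := fun x hx => mem_setN.2 (Or.inr hx)
      have h0 := ih (n - s n - 1) (by omega) (u := u) (v := v)
      rcases huv with h | h | ⟨i, hi, h⟩ | h | ⟨i, hi, h | h | ⟨h, rfl⟩⟩ | h | h | h | h | h | h | h
      · exact ⟨.inl (h0 h).1, .inl (h0 h).2⟩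
      all_goals grind

/-- The out-neighbours of a vertex of `G_{n'}` in `G_n`. -/
lemma edges_from_verts (h : 5 ≤ n) {u v : Vtx} (hu : u ∈ verts s t (n - s n - 1))
    (huv : (u, v) ∈ edges s t n) :
    (u, v) ∈ edges s t (n - s n - 1) ∨ v ∈ setA s n ∨ v ∈ setB t n := by
  have key : ∀ p : Part, u ∉ p.toFinset s t n := fun p hp => Part.notMem_verts h hp hu
  have hm : u ∉ setM s n := key .m
  have hd : u ∉ setD s n := key .d
  have ha : u ∉ setA s n := key .a
  have hb : u ∉ setB t n := key .b
  have hc : ∀ i, u ∉ setC s n i := fun i => key (.c i)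
  rw [mem_edges h, mem_setN] at huv
  grind

/-- The edges of `G_n` that start in a part of level `n`. -/
lemma edges_from_part (h : 5 ≤ n) {p : Part} {u v : Vtx} (hu : u ∈ p.toFinset s t n)
    (huv : (u, v) ∈ edges s t n) :
    -- No restriction is recorded for edges out of `N`: once the cops hold `N`, the robber never
    -- uses them.
    (p = .m ∨ p = .d) ∨
    (∃ i, p = .c i ∧ (v ∈ setC s n i ∨ v ∈ setD s n ∨ v = Vtx.b n i)) ∨
    (p = .a ∧ (v ∈ setA s n ∨ v ∈ setB t n ∨ v ∈ setM s n ∨ v ∈ verts s t (n - s n - 1))) ∨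
    (p = .b ∧ v ∈ setA s n) := by
  have h0 := Part.notMem_verts h hu
  have hE : (u, v) ∉ edges s t (n - s n - 1) := fun h' => h0 (mem_verts_of_mem_edges h').1
  have hm : u ∈ setM s n → p = .m := fun h' => Part.eq_of_mem hu (q := .m) h'
  have hd : u ∈ setD s n → p = .d := fun h' => Part.eq_of_mem hu (q := .d) h'
  have ha : u ∈ setA s n → p = .a := fun h' => Part.eq_of_mem hu (q := .a) h'
  have hb : u ∈ setB t n → p = .b := fun h' => Part.eq_of_mem hu (q := .b) h'
  have hc : ∀ i, u ∈ setC s n i → p = .c i := fun i h' => Part.eq_of_mem hu (q := .c i) h'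
  rw [mem_edges h, mem_setN] at huv
  grind

lemma edges_from_setC (h : 5 ≤ n) {i : ℕ} {u v : Vtx} (hu : u ∈ setC s n i)
    (huv : (u, v) ∈ edges s t n) : v ∈ setC s n i ∨ v ∈ setD s n ∨ v = Vtx.b n i := by
  have := edges_from_part h (p := .c i) hu huv
  grind

lemma edges_from_setA (h : 5 ≤ n) {u v : Vtx} (hu : u ∈ setA s n)
    (huv : (u, v) ∈ edges s t n) :
    v ∈ setA s n ∨ v ∈ setB t n ∨ v ∈ setM s n ∨ v ∈ verts s t (n - s n - 1) := by
  have := edges_from_part h (p := .a) hu huv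
  grind

lemma edges_from_setB (h : 5 ≤ n) {u v : Vtx} (hu : u ∈ setB t n)
    (huv : (u, v) ∈ edges s t n) : v ∈ setA s n := by
  have := edges_from_part h (p := .b) hu huv
  grind

lemma verts_subset_verts (h : 5 ≤ n) : verts s t (n - s n - 1) ⊆ verts s t n :=
  fun _ hv => (mem_verts h).2 (.inl hv)

lemma edges_subset_edges (h : 5 ≤ n) : edges s t (n - s n - 1) ⊆ edges s t n :=
  fun ⟨_, _⟩ hv => (mem_edges h).2 (.inl hv)

lemma setN_subset_verts (h : 5 ≤ n) : setN s n ⊆ verts s t n :=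
  fun _ hv => (mem_verts h).2 (.inr (.inr (.inr (.inr hv))))

lemma setA_subset_verts (h : 5 ≤ n) : setA s n ⊆ verts s t n :=
  fun _ hv => (mem_verts h).2 (.inr (.inl hv))

lemma setB_subset_verts (h : 5 ≤ n) : setB t n ⊆ verts s t n :=
  fun _ hv => (mem_verts h).2 (.inr (.inr (.inl hv)))

lemma setC_subset_verts (h : 5 ≤ n) {i : ℕ} (hi : i < t n) : setC s n i ⊆ verts s t n :=
  fun _ hv => (mem_verts h).2 (.inr (.inr (.inr (.inl ⟨i, hi, hv⟩))))

lemma le_of_mem_levels : ∀ {n ℓ : ℕ}, ℓ ∈ levels s n → 5 ≤ ℓ ∧ ℓ ≤ n := by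
  intro n
  induction n using Nat.strong_induction_on with
  | _ n ih =>
    intro ℓ hℓ
    rcases lt_or_ge n 5 with h | h
    · rw [levels_of_lt h] at hℓ
      simp at hℓ
    · rw [levels_of_le h, Finset.mem_insert] at hℓ
      rcases hℓ with rfl | hℓ
      · exact ⟨h, le_rfl⟩
      · have := ih _ (by omega) hℓ
        omega

lemma notMem_levels (h : 5 ≤ n) : n ∉ levels s (n - s n - 1) := by
  intro h'
  have := (le_of_mem_levels h').2
  omega

lemma card_levels (h : 5 ≤ n) : (levels s n).card = (levels s (n - s n - 1)).card + 1 := by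
  rw [levels_of_le h, Finset.card_insert_of_notMem (notMem_levels h)]

lemma verts_eq (h : 5 ≤ n) : verts s t n = verts s t (n - s n - 1) ∪ setA s n ∪ setB t n ∪
    (Finset.range (t n)).biUnion (setC s n) ∪ setN s n := by
  rw [verts, if_neg (by omega)]

end Membership

/-! ### Bounds on `s` -/

section Growth

variable {s : ℕ → ℕ}

/-- A bound on `s` from a lower bound `p / q` on the logarithm. -/
lemma mul_lt_mul_of_exp_le (hs : ∀ n : ℕ, 5 ≤ n → 2 ≤ s n ∧ (s n : ℝ) < (n : ℝ) / Real.log n)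
    {n m p q : ℕ} (hm : 5 ≤ m) (hmn : m ≤ n) (hq : 0 < q)
    (hpq : (2.7182818286 : ℝ) ^ p ≤ (m : ℝ) ^ q) : p * s n < q * n := by
  have hm0 : (0 : ℝ) < m := by exact_mod_cast (by omega : 0 < m)
  have hn0 : (0 : ℝ) < n := by exact_mod_cast (by omega : 0 < n)
  -- The decimal constant exceeds `e`, so `hpq` gives `p / q ≤ log m ≤ log n`.
  have h1 : (p : ℝ) ≤ q * Real.log n := by
    have h2 : Real.exp p ≤ (m : ℝ) ^ q := by
      rw [← Real.exp_one_pow]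
      exact (pow_le_pow_left₀ (Real.exp_pos _).le Real.exp_one_lt_d9.le p).trans hpq
    have h3 := (Real.le_log_iff_exp_le (by positivity)).2 h2
    rw [Real.log_pow] at h3
    refine h3.trans ?_
    gcongr
  have hlog : 0 < Real.log n := Real.log_pos (by exact_mod_cast (by omega : 1 < n))
  have h4 := (lt_div_iff₀ hlog).1 (hs n (by omega)).2
  have hq0 : (0 : ℝ) < q := by exact_mod_cast hq
  have : (p : ℝ) * s n < q * n := by
    calc (p : ℝ) * s n ≤ q * Real.log n * s n := by gcongr
      _ = q * (s n * Real.log n) := by ring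
      _ < q * n := by gcongr
  exact_mod_cast this

/-- This is `3/2 ≤ log 5`. It leaves `n - s n ≥ 2`, so that a single cop fills neither `M` nor any
`C_i`. -/
lemma three_mul_lt (hs : ∀ n : ℕ, 5 ≤ n → 2 ≤ s n ∧ (s n : ℝ) < (n : ℝ) / Real.log n)
    {n : ℕ} (hn : 5 ≤ n) : 3 * s n < 2 * n :=
  mul_lt_mul_of_exp_le hs le_rfl hn (by norm_num) (by norm_num)

end Growth


/-! ### Pursuits: the robber's view of a decomposition -/

/-- A robber who runs along the edges `E` is pursued by cops that occupy the sets `bag d`.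
`Pos P d u` says that the cops are moving from `P` to `bag d` and that the robber at `u` is in the
territory that remains for him. -/
structure Pursuit (α I : Type) [DecidableEq α] (E : Finset (α × α)) where
  bag : I → Finset α
  child : I → I → Prop
  wf : WellFounded fun e d => child d e
  Pos : Finset α → I → α → Prop
  notMem : ∀ {P d u}, Pos P d u → u ∉ P
  -- During a move only the vertices in both the old and the new position are blocked; together with
  -- `notMem` this makes the pursuit monotone.
  step : ∀ {P d u v}, Pos P d u → (u, v) ∈ E → (v ∈ P → v ∉ bag d) → Pos P d v
  next : ∀ {P d u}, Pos P d u → u ∉ bag d → ∃ e, child d e ∧ Pos (bag d) e u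

namespace Pursuit

variable {α I : Type} [DecidableEq α] {E : Finset (α × α)} (𝓡 : Pursuit α I E)

/-- A robber strategy that can be continued until `goal` holds makes `goal` true. -/
lemma pursue {inv : Finset α → I → Prop} {goal : Prop}
    (h : ∀ P d, inv P d → goal ∨ ∃ u, 𝓡.Pos P d u ∧ u ∉ 𝓡.bag d ∧
      ∀ e, 𝓡.Pos (𝓡.bag d) e u → inv (𝓡.bag d) e) {P : Finset α} {d : I} (hP : inv P d) :
    goal := by
  induction d using 𝓡.wf.induction generalizing P with
  | _ d ih =>
    rcases h P d hP with hg | ⟨u, hu, hud, he⟩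
    · exact hg
    · obtain ⟨e, hde, hue⟩ := 𝓡.next hu hud
      exact ih e hde (he e hue)

variable {𝓡}

/-- A cop next to the robber cannot leave. -/
lemma Pos.mem_bag {P : Finset α} {d : I} {u v : α} (h : 𝓡.Pos P d u) (huv : (u, v) ∈ E)
    (hv : v ∈ P) : v ∈ 𝓡.bag d := by
  by_contra hd
  exact 𝓡.notMem (𝓡.step h huv fun _ => hd) hv

lemma Pos.step_of_notMem_bag {P : Finset α} {d : I} {u v : α} (h : 𝓡.Pos P d u)
    (huv : (u, v) ∈ E) (hv : v ∉ 𝓡.bag d) : 𝓡.Pos P d v := 𝓡.step h huv fun _ => hv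

lemma Pos.step_of_notMem {P : Finset α} {d : I} {u v : α} (h : 𝓡.Pos P d u)
    (huv : (u, v) ∈ E) (hv : v ∉ P) : 𝓡.Pos P d v := 𝓡.step h huv fun h => absurd h hv

end Pursuit

/-- Used in the form: beyond a set that the cops must hold, only one cop is free, and he cannot
cover two vertices. -/
lemma eq_of_card_le_card_add_one {α : Type} [DecidableEq α] {T X : Finset α} (hTX : T ⊆ X)
    (hcard : X.card ≤ T.card + 1) {x y : α} (hx : x ∈ X) (hy : y ∈ X) (hxT : x ∉ T)
    (hyT : y ∉ T) : x = y := by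
  have h : (X \ T).card ≤ 1 := by
    have := Finset.card_sdiff_add_card_eq_card hTX
    omega
  exact Finset.card_le_one.1 h x (Finset.mem_sdiff.2 ⟨hx, hxT⟩) y (Finset.mem_sdiff.2 ⟨hy, hyT⟩)

/-! ### The robber's strategy -/

section LowerBound

variable {s t : ℕ → ℕ} {I : Type} {E : Finset (Vtx × Vtx)}

/-- If the cops get hold of `N` with at most one further cop, then the robber in `N` has access to
all of `G_n`. -/
lemma pos_of_setN_subset {n : ℕ} (hn : 5 ≤ n) (hsn : 2 ≤ n - s n) (htn : 2 ≤ t n)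
    (𝓡 : Pursuit Vtx I E) (hE : edges s t n ⊆ E) {Z : Finset Vtx} (hZ : Disjoint Z (verts s t n))
    {P : Finset Vtx} {d : I} {u : Vtx} (hu : u ∈ setN s n) (hpos : 𝓡.Pos P d u)
    (hbag : Z ∪ setN s n ⊆ 𝓡.bag d) (hcard : (𝓡.bag d).card ≤ (Z ∪ setN s n).card + 1)
    {w : Vtx} (hw : w ∈ verts s t n) (hwd : w ∉ 𝓡.bag d) : 𝓡.Pos P d w := by
  have hE' : ∀ {x y}, (x, y) ∈ edges s t n → (x, y) ∈ E := fun h => hE h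
  -- With one cop outside `Z ∪ N`, each `C_i` and also `B` keeps a free vertex; these open the way
  -- to `b_i` and to `A`.
  have hone : ∀ {x y}, x ∈ verts s t n → y ∈ verts s t n → x ∈ 𝓡.bag d → y ∈ 𝓡.bag d →
      x ∉ setN s n → y ∉ setN s n → x = y := by
    intro x y hx hy hxd hyd hxN hyN
    refine eq_of_card_le_card_add_one hbag hcard hxd hyd ?_ ?_ <;>
      rw [Finset.mem_union, not_or]
    · exact ⟨fun h => Finset.disjoint_left.1 hZ h hx, hxN⟩
    · exact ⟨fun h => Finset.disjoint_left.1 hZ h hy, hyN⟩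
  have hcN : ∀ i k, Vtx.c n i k ∉ setN s n := by simp [setN, setM, setD]
  have hbN : ∀ i, Vtx.b n i ∉ setN s n := by simp [setN, setM, setD]
  have hcm : ∀ {i k}, k < n - s n → Vtx.c n i k ∈ setC s n i :=
    fun hk => mem_setC.2 ⟨_, hk, rfl⟩
  have hcv : ∀ {i k}, i < t n → k < n - s n → Vtx.c n i k ∈ verts s t n :=
    fun hi hk => setC_subset_verts hn hi (hcm hk)
  have hbv : ∀ {i}, i < t n → Vtx.b n i ∈ verts s t n :=
    fun hi => setB_subset_verts hn (mem_setB.2 ⟨_, hi, rfl⟩)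
  have hposC : ∀ {i k}, i < t n → k < n - s n → Vtx.c n i k ∉ 𝓡.bag d →
      𝓡.Pos P d (Vtx.c n i k) := fun {i k} hi hk hc =>
    hpos.step_of_notMem_bag (hE' ((mem_edges hn).2 (by
      have := hcm (i := i) hk
      grind))) hc
  have hposB : ∀ {i}, i < t n → Vtx.b n i ∉ 𝓡.bag d → 𝓡.Pos P d (Vtx.b n i) := by
    intro i hi hb
    have : ∃ k < n - s n, Vtx.c n i k ∉ 𝓡.bag d := by
      by_contra! hcon
      have := hone (hcv hi (by omega)) (hcv hi (by omega)) (hcon 0 (by omega)) (hcon 1 (by omega))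
        (hcN _ _) (hcN _ _)
      simp at this
    obtain ⟨k, hk, hkc⟩ := this
    refine (hposC hi hk hkc).step_of_notMem_bag (hE' ((mem_edges hn).2 ?_)) hb
    have := hcm (i := i) hk
    grind
  rcases (mem_verts hn).1 hw with hw' | hw' | hw' | ⟨i, hi, hw'⟩ | hw'
  · exact hpos.step_of_notMem_bag (hE' ((mem_edges hn).2 (by grind))) hwd
  · have : ∃ i < t n, Vtx.b n i ∉ 𝓡.bag d := by
      by_contra! hcon
      have := hone (hbv (by omega)) (hbv (by omega)) (hcon 0 (by omega)) (hcon 1 (by omega))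
        (hbN _) (hbN _)
      simp at this
    obtain ⟨i, hi, hib⟩ := this
    refine (hposB hi hib).step_of_notMem_bag (hE' ((mem_edges hn).2 ?_)) hwd
    have : Vtx.b n i ∈ setB t n := mem_setB.2 ⟨_, hi, rfl⟩
    grind
  · obtain ⟨i, hi, rfl⟩ := mem_setB.1 hw'
    exact hposB hi hwd
  · obtain ⟨k, hk, rfl⟩ := mem_setC.1 hw'
    exact hposC hi hk hwd
  · exact absurd (hbag (Finset.mem_union_right _ hw')) hwd

/-- The robber forces the cops to occupy `N ∪ {b_i}` while he still has access to `G_{n'}`. -/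
lemma exists_bag_eq {n : ℕ} (hn : 5 ≤ n) (hs2 : 2 ≤ s n) (hsn : 2 ≤ n - s n) (htn : 2 ≤ t n)
    (𝓡 : Pursuit Vtx I E) (hE : edges s t n ⊆ E) {Z : Finset Vtx} (hZ : Disjoint Z (verts s t n))
    (hZE : ∀ w ∈ verts s t n, ∀ z ∈ Z, (w, z) ∈ E)
    (hcard : ∀ d, (𝓡.bag d).card ≤ Z.card + n + 1) {i : ℕ} (hi : i < t n)
    {P : Finset Vtx} {d : I} {u : Vtx} (hZP : Z ⊆ P) (hu : u ∈ setN s n) (hpos : 𝓡.Pos P d u) :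
    ∃ P d, 𝓡.bag d = insert (Vtx.b n i) (Z ∪ setN s n) ∧
      ∀ w ∈ verts s t (n - s n - 1), 𝓡.Pos P d w := by
  have hE' : ∀ {x y}, (x, y) ∈ edges s t n → (x, y) ∈ E := fun h => hE h
  have hZN : Disjoint Z (setN s n) := hZ.mono_right (setN_subset_verts hn)
  have hZNcard : (Z ∪ setN s n).card = Z.card + n := by
    rw [Finset.card_union_of_disjoint hZN, card_setN (by omega)]
  have hbm : Vtx.b n i ∈ setB t n := mem_setB.2 ⟨_, hi, rfl⟩
  have hbv : Vtx.b n i ∈ verts s t n := setB_subset_verts hn hbm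
  have hbZN : Vtx.b n i ∉ Z ∪ setN s n := by
    rw [Finset.mem_union, not_or]
    exact ⟨fun h => Finset.disjoint_left.1 hZ h hbv, by simp [setN, setM, setD]⟩
  -- `Z`, `N` and `b_i` already use up all `|Z| + n + 1` cops.
  have hexact : ∀ d, Z ∪ setN s n ⊆ 𝓡.bag d → Vtx.b n i ∈ 𝓡.bag d →
      𝓡.bag d = insert (Vtx.b n i) (Z ∪ setN s n) := by
    intro d h hb
    refine (Finset.eq_of_subset_of_card_le (Finset.insert_subset hb h) ?_).symm
    rw [Finset.card_insert_of_notMem hbZN, hZNcard]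
    exact hcard d
  have hnotbag : ∀ d, 𝓡.bag d = insert (Vtx.b n i) (Z ∪ setN s n) →
      ∀ w ∈ verts s t (n - s n - 1), w ∉ 𝓡.bag d := by
    intro d h w hw
    rw [h]
    simp only [Finset.mem_insert, Finset.mem_union, not_or]
    refine ⟨?_, fun h => Finset.disjoint_left.1 hZ h (verts_subset_verts hn hw), ?_⟩
    · rintro rfl
      exact Part.notMem_verts (p := .b) hn hbm hw
    · rw [mem_setN, not_or]
      exact ⟨fun h => Part.notMem_verts (p := .m) hn h hw,
        fun h => Part.notMem_verts (p := .d) hn h hw⟩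
  -- the robber waits in `N`
  obtain ⟨P, d, u, hu, hpos, hbag⟩ : ∃ P d u, u ∈ setN s n ∧ 𝓡.Pos P d u ∧
      Z ∪ setN s n ⊆ 𝓡.bag d := by
    refine 𝓡.pursue (inv := fun P d => Z ⊆ P ∧ ∃ u ∈ setN s n, 𝓡.Pos P d u) ?_
      ⟨hZP, u, hu, hpos⟩
    rintro P d ⟨hZP, u, hu, hpos⟩
    have hZd : Z ⊆ 𝓡.bag d := fun z hz =>
      hpos.mem_bag (hZE u (setN_subset_verts hn hu) z hz) (hZP hz)
    by_cases hN : setN s n ⊆ 𝓡.bag d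
    · exact .inl ⟨P, d, u, hu, hpos, Finset.union_subset hZd hN⟩
    · obtain ⟨v, hv, hvd⟩ := Finset.not_subset.1 hN
      refine .inr ⟨v, ?_, hvd, fun e he => ⟨hZd, v, hv, he⟩⟩
      by_cases huv : u = v
      · exact huv ▸ hpos
      · exact hpos.step_of_notMem_bag (hE' ((mem_edges hn).2 (by grind))) hvd
  have hall : ∀ w ∈ verts s t n, w ∉ 𝓡.bag d → 𝓡.Pos P d w := fun w hw hwd =>
    pos_of_setN_subset hn hsn htn 𝓡 hE hZ hu hpos hbag (hZNcard ▸ hcard d) hw hwd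
  by_cases hb : Vtx.b n i ∈ 𝓡.bag d
  · have := hexact d hbag hb
    exact ⟨P, d, this, fun w hw => hall w (verts_subset_verts hn hw) (hnotbag d this w hw)⟩
  -- a set with at most one vertex outside `Z ∪ N` does not contain two others
  have hone : ∀ {X : Finset Vtx}, Z ∪ setN s n ⊆ X → X.card ≤ Z.card + n + 1 →
      ∀ {x y}, x ∈ verts s t n → y ∈ verts s t n → x ∈ X → y ∈ X →
      x ∉ setN s n → y ∉ setN s n → x = y := by
    intro X hX hXc x y hx hy hxd hyd hxN hyN
    refine eq_of_card_le_card_add_one hX (hZNcard ▸ hXc) hxd hyd ?_ ?_ <;>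
      rw [Finset.mem_union, not_or]
    · exact ⟨fun h => Finset.disjoint_left.1 hZ h hx, hxN⟩
    · exact ⟨fun h => Finset.disjoint_left.1 hZ h hy, hyN⟩
  have hcm : ∀ {k}, k < n - s n → Vtx.c n i k ∈ setC s n i := fun hk => mem_setC.2 ⟨_, hk, rfl⟩
  have hcfree : ∀ {X : Finset Vtx}, Z ∪ setN s n ⊆ X → X.card ≤ Z.card + n + 1 →
      ∃ v ∈ setC s n i, v ∉ X := by
    intro X hX hXc
    by_contra! hcon
    have := hone hX hXc (setC_subset_verts hn hi (hcm (k := 0) (by omega)))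
      (setC_subset_verts hn hi (hcm (k := 1) (by omega))) (hcon _ (hcm (by omega)))
      (hcon _ (hcm (by omega))) (by simp [setN, setM, setD]) (by simp [setN, setM, setD])
    simp at this
  have hafree : ∀ {X : Finset Vtx}, Z ∪ setN s n ⊆ X → X.card ≤ Z.card + n + 1 →
      ∃ a ∈ setA s n, a ∉ X := by
    intro X hX hXc
    by_contra! hcon
    have ham : ∀ {k}, k < s n → Vtx.a n k ∈ setA s n := fun hk => mem_setA.2 ⟨_, hk, rfl⟩
    have := hone hX hXc (setA_subset_verts hn (ham (k := 0) (by omega)))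
      (setA_subset_verts hn (ham (k := 1) (by omega))) (hcon _ (ham (by omega)))
      (hcon _ (ham (by omega))) (by simp [setN, setM, setD]) (by simp [setN, setM, setD])
    simp at this
  -- the robber waits in `C_i`
  obtain ⟨v, hv, hvd⟩ := hcfree hbag (hcard d)
  obtain ⟨e, -, hve⟩ := 𝓡.next (hall v (setC_subset_verts hn hi hv) hvd) hvd
  refine 𝓡.pursue (inv := fun P d => Z ∪ setN s n ⊆ P ∧ P.card ≤ Z.card + n + 1 ∧
    Vtx.b n i ∉ P ∧ ∃ v ∈ setC s n i, 𝓡.Pos P d v) ?_ ⟨hbag, hcard d, hb, v, hv, hve⟩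
  rintro P d ⟨hP, hPc, hbP, v, hv, hpos⟩
  -- As `b_i ∉ P`, it cannot be blocked during this move. The robber passes through it to a free
  -- vertex of `A`, from where he sees `M`; from `C_i` he sees `D`. So no cop on `Z ∪ N` may leave.
  have hposb : 𝓡.Pos P d (Vtx.b n i) :=
    hpos.step_of_notMem (hE' ((mem_edges hn).2 (by grind))) hbP
  obtain ⟨a, ha, haP⟩ := hafree hP hPc
  have hposa : 𝓡.Pos P d a := hposb.step_of_notMem (hE' ((mem_edges hn).2 (by grind))) haP
  have hd : Z ∪ setN s n ⊆ 𝓡.bag d := by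
    intro z hz
    rcases Finset.mem_union.1 hz with hz' | hz'
    · exact hpos.mem_bag (hZE v (setC_subset_verts hn hi hv) z hz') (hP hz)
    · rcases mem_setN.1 hz' with hz'' | hz''
      · exact hposa.mem_bag (hE' ((mem_edges hn).2 (by grind))) (hP hz)
      · exact hpos.mem_bag (hE' ((mem_edges hn).2 (by grind))) (hP hz)
  -- If `b_i` is being taken just now, the robber is still able to run through it into `A` and on to
  -- `G_{n'}`.
  by_cases hbd : Vtx.b n i ∈ 𝓡.bag d
  · refine .inl ⟨P, d, hexact d hd hbd, fun w hw => ?_⟩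
    exact hposa.step_of_notMem_bag (hE' ((mem_edges hn).2 (by grind)))
      (hnotbag d (hexact d hd hbd) w hw)
  · obtain ⟨v', hv', hv'd⟩ := hcfree hd (hcard d)
    refine .inr ⟨v', ?_, hv'd, fun e he => ⟨hd, hcard d, hbd, v', hv', he⟩⟩
    by_cases hvv : v = v'
    · exact hvv ▸ hpos
    · exact hpos.step_of_notMem_bag (hE' ((mem_edges hn).2 (by grind))) hv'd

/-- The robber in `G_{n'}` forces the cops to occupy `A` while they keep `b_i`. -/
lemma exists_pos_setN {n : ℕ} (hn : 5 ≤ n) (hs : s n ≤ n) (hn' : (setN s (n - s n - 1)).Nonempty)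
    (hN' : setN s (n - s n - 1) ⊆ verts s t (n - s n - 1))
    (hsV : s n < (verts s t (n - s n - 1)).card)
    (𝓡 : Pursuit Vtx I E) (hE : edges s t n ⊆ E) {Z : Finset Vtx} (hZ : Disjoint Z (verts s t n))
    (hZE : ∀ w ∈ verts s t n, ∀ z ∈ Z, (w, z) ∈ E)
    (hcard : ∀ d, (𝓡.bag d).card ≤ Z.card + n + 1) {i : ℕ} (hi : i < t n)
    {P : Finset Vtx} {d : I} {u : Vtx} (hP : insert (Vtx.b n i) (Z ∪ setM s n) ⊆ P)
    (hA : ¬ setA s n ⊆ P)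
    (hu : u ∈ verts s t (n - s n - 1)) (hpos : 𝓡.Pos P d u) :
    ∃ P d, insert (Vtx.b n i) (Z ∪ setA s n) ⊆ P ∧ ∃ w ∈ setN s (n - s n - 1), 𝓡.Pos P d w := by
  have hE' : ∀ {x y}, (x, y) ∈ edges s t n → (x, y) ∈ E := fun h => hE h
  have hbm : Vtx.b n i ∈ setB t n := mem_setB.2 ⟨_, hi, rfl⟩
  have hbv : Vtx.b n i ∈ verts s t n := setB_subset_verts hn hbm
  have hMv : setM s n ⊆ verts s t n := fun x hx => setN_subset_verts hn (mem_setN.2 (.inl hx))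
  have hTcard : (insert (Vtx.b n i) (Z ∪ setM s n)).card = Z.card + (n - s n) + 1 := by
    rw [Finset.card_insert_of_notMem, Finset.card_union_of_disjoint (hZ.mono_right hMv), card_setM]
    rw [Finset.mem_union, not_or]
    exact ⟨fun h => Finset.disjoint_left.1 hZ h hbv, by simp [setM]⟩
  have hdisj : ∀ X : Finset Vtx, X ⊆ verts s t n → (∀ x ∈ X, x ≠ Vtx.b n i) →
      Disjoint X (setM s n) → Disjoint (insert (Vtx.b n i) (Z ∪ setM s n)) X := by
    intro X hX hXb hXM
    rw [Finset.disjoint_insert_left, Finset.disjoint_union_left]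
    exact ⟨fun h => hXb _ h rfl, hZ.mono_right hX, hXM.symm⟩
  have hdisjV : Disjoint (insert (Vtx.b n i) (Z ∪ setM s n)) (verts s t (n - s n - 1)) := by
    refine hdisj _ (verts_subset_verts hn) ?_ ?_
    · rintro x hx rfl
      exact Part.notMem_verts (p := .b) hn hbm hx
    · exact Finset.disjoint_right.2 fun x h hx => Part.notMem_verts (p := .m) hn h hx
  have hdisjA : Disjoint (insert (Vtx.b n i) (Z ∪ setM s n)) (setA s n) := by
    refine hdisj _ (setA_subset_verts hn) ?_ ?_
    · rintro x hx rfl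
      simp [setA] at hx
    · exact Finset.disjoint_left.2 fun x h hx =>
        absurd (Part.eq_of_mem (t := t) (p := .a) (q := .m) h hx) (by simp)
  refine 𝓡.pursue (inv := fun P d => insert (Vtx.b n i) (Z ∪ setM s n) ⊆ P ∧ ¬ setA s n ⊆ P ∧
    ∃ u ∈ verts s t (n - s n - 1), 𝓡.Pos P d u) ?_ ⟨hP, hA, u, hu, hpos⟩
  rintro P d ⟨hP, hA, u, hu, hpos⟩
  -- A free vertex of `A` shows the robber `M`. The set `D` is no longer in sight, so its cops may
  -- be moved.
  obtain ⟨a, ha, haP⟩ := Finset.not_subset.1 hA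
  have hposa : 𝓡.Pos P d a := hpos.step_of_notMem (hE' ((mem_edges hn).2 (by grind))) haP
  have hd : insert (Vtx.b n i) (Z ∪ setM s n) ⊆ 𝓡.bag d := by
    intro z hz
    rcases Finset.mem_insert.1 hz with rfl | hz'
    · exact hpos.mem_bag (hE' ((mem_edges hn).2 (by grind))) (hP hz)
    rcases Finset.mem_union.1 hz' with hz' | hz'
    · exact hpos.mem_bag (hZE u (verts_subset_verts hn hu) z hz') (hP hz)
    · exact hposa.mem_bag (hE' ((mem_edges hn).2 (by grind))) (hP hz)
  have hposV : ∀ w ∈ verts s t (n - s n - 1), w ∉ 𝓡.bag d → 𝓡.Pos P d w := fun w hw hwd =>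
    hposa.step_of_notMem_bag (hE' ((mem_edges hn).2 (by grind))) hwd
  by_cases hAd : setA s n ⊆ 𝓡.bag d
  -- Filling `A` takes every remaining cop, so `G_{n'}` is empty of cops.
  · have heq : insert (Vtx.b n i) (Z ∪ setM s n) ∪ setA s n = 𝓡.bag d := by
      refine Finset.eq_of_subset_of_card_le (Finset.union_subset hd hAd) ?_
      rw [Finset.card_union_of_disjoint hdisjA, hTcard, card_setA]
      have := hcard d
      omega
    obtain ⟨w, hw⟩ := hn'
    have hwd : w ∉ 𝓡.bag d := by
      rw [← heq, Finset.mem_union, not_or]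
      exact ⟨fun h => Finset.disjoint_left.1 hdisjV h (hN' hw),
        fun h => Part.notMem_verts (p := .a) hn h (hN' hw)⟩
    obtain ⟨e, -, he⟩ := 𝓡.next (hposV w (hN' hw) hwd) hwd
    refine .inl ⟨𝓡.bag d, e, ?_, w, hw, he⟩
    intro x hx
    rcases Finset.mem_insert.1 hx with rfl | hx
    · exact hd (Finset.mem_insert_self _ _)
    · rcases Finset.mem_union.1 hx with hx | hx
      · exact hd (Finset.mem_insert_of_mem (Finset.mem_union_left _ hx))
      · exact hAd hx
  -- Only `s n` cops are left outside the forced set, fewer than `G_{n'}` has vertices.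
  · have hfree : ∃ w ∈ verts s t (n - s n - 1), w ∉ 𝓡.bag d := by
      by_contra! hcon
      have h1 := Finset.card_le_card (Finset.union_subset hd hcon)
      rw [Finset.card_union_of_disjoint hdisjV, hTcard] at h1
      have := hcard d
      omega
    obtain ⟨w, hw, hwd⟩ := hfree
    exact .inr ⟨w, hposV w hw hwd, hwd, fun e he => ⟨hd, hAd, w, hw, he⟩⟩

/-- The sets `N`, `C_0`, `C_1` and `A` already have `3n - s n` vertices. Applied to `n'`, this gives
more than `2n' + 1 ≥ s n` vertices, so the cops freed from `D` cannot fill `G_{n'}`. -/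
lemma two_mul_add_one_lt_card_verts {n : ℕ} (hn : 5 ≤ n) (hsn : 3 * s n < 2 * n)
    (htn : 2 ≤ t n) : 2 * n + 1 < (verts s t n).card := by
  have hsub : setN s n ∪ setC s n 0 ∪ setC s n 1 ∪ setA s n ⊆ verts s t n :=
    Finset.union_subset (Finset.union_subset (Finset.union_subset (setN_subset_verts hn)
      (setC_subset_verts hn (by omega))) (setC_subset_verts hn (by omega))) (setA_subset_verts hn)
  have h := Finset.card_le_card hsub
  rw [Finset.card_union_of_disjoint, Finset.card_union_of_disjoint,
    Finset.card_union_of_disjoint, card_setN (by omega), card_setC, card_setC, card_setA] at h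
  · omega
  all_goals
    rw [Finset.disjoint_left]
    simp only [Finset.mem_union, setN, setM, setD, setC, setA, Finset.mem_image]
    grind

/-- For every choice of indices `f ℓ`, some bag of a pursuit of width `n + 1` meets each set `B(ℓ)`
exactly in `b_{f ℓ}(ℓ)`. -/
lemma exists_bag_of_choice
    (hs : ∀ n : ℕ, 5 ≤ n → 2 ≤ s n ∧ (s n : ℝ) < (n : ℝ) / Real.log n)
    (ht : ∀ n : ℕ, 5 ≤ n → 2 ≤ t n) (𝓡 : Pursuit Vtx I E) (f : ℕ → ℕ) :
    ∀ {n : ℕ}, 5 ≤ n → (∀ ℓ ∈ levels s n, f ℓ < t ℓ) → edges s t n ⊆ E →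
    ∀ {Z : Finset Vtx}, Disjoint Z (verts s t n) →
    (∀ w ∈ verts s t n, ∀ z ∈ Z, (w, z) ∈ E) →
    (∀ d, (𝓡.bag d).card ≤ Z.card + n + 1) →
    ∀ {P : Finset Vtx} {d : I} {u : Vtx}, Z ⊆ P → u ∈ setN s n → 𝓡.Pos P d u →
    ∃ e, Z ⊆ 𝓡.bag e ∧ 𝓡.bag e ⊆ Z ∪ verts s t n ∧ (𝓡.bag e).card = Z.card + n + 1 ∧
      ∀ ℓ ∈ levels s n, ∀ j < t ℓ, Vtx.b ℓ j ∈ 𝓡.bag e ↔ j = f ℓ := by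
  intro n
  induction n using Nat.strong_induction_on with
  | _ n ih =>
    intro hn hf hE Z hZ hZE hcard P d u hZP hu hpos
    have hs2 := (hs n hn).1
    have hsn := three_mul_lt hs hn
    have htn := ht n hn
    have hE' : ∀ {x y}, (x, y) ∈ edges s t n → (x, y) ∈ E := fun h => hE h
    have hmem : n ∈ levels s n := by
      rw [levels_of_le hn]
      exact Finset.mem_insert_self _ _
    have hi := hf n hmem
    have hbm : Vtx.b n (f n) ∈ setB t n := mem_setB.2 ⟨_, hi, rfl⟩
    have hbv : Vtx.b n (f n) ∈ verts s t n := setB_subset_verts hn hbm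
    obtain ⟨P', d', hbag, hV⟩ := exists_bag_eq hn hs2 (by omega) htn 𝓡 hE hZ hZE hcard hi hZP hu
      hpos
    have hZb : ∀ j < t n, Vtx.b n j ∉ Z := fun j hj h =>
      Finset.disjoint_left.1 hZ h (setB_subset_verts hn (mem_setB.2 ⟨_, hj, rfl⟩))
    rcases lt_or_ge (n - s n - 1) 5 with hn' | hn'
    · refine ⟨d', ?_, ?_, ?_, ?_⟩
      · rw [hbag]
        exact Finset.subset_union_left.trans (Finset.subset_insert _ _)
      · rw [hbag]
        exact Finset.insert_subset (Finset.mem_union_right _ hbv)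
          (Finset.union_subset_union_right (setN_subset_verts hn))
      · rw [hbag, Finset.card_insert_of_notMem, Finset.card_union_of_disjoint
          (hZ.mono_right (setN_subset_verts hn)), card_setN (by omega)]
        rw [Finset.mem_union, not_or]
        exact ⟨hZb _ hi, by simp [setN, setM, setD]⟩
      · intro ℓ hℓ j hj
        rw [levels_of_le hn, levels_of_lt hn', Finset.mem_insert] at hℓ
        rcases hℓ with rfl | hℓ
        · rw [hbag]
          have := hZb j hj
          simp [this, setN, setM, setD]
        · simp at hℓ
    · have hN' := setN_subset_verts (s := s) (t := t) hn'
      have hsn' := three_mul_lt hs hn'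
      have hV2 := two_mul_add_one_lt_card_verts (s := s) (t := t) hn' hsn' (ht _ hn')
      have hne : (setN s (n - s n - 1)).Nonempty := by
        rw [← Finset.card_pos, card_setN (by omega)]
        omega
      obtain ⟨w, hw⟩ := hne
      have hnotbag : w ∉ 𝓡.bag d' := by
        rw [hbag]
        simp only [Finset.mem_insert, Finset.mem_union, not_or]
        have hwv := hN' hw
        refine ⟨?_, fun h => Finset.disjoint_left.1 hZ h (verts_subset_verts hn hwv), ?_⟩
        · rintro rfl
          exact Part.notMem_verts (p := .b) hn hbm hwv
        · rw [mem_setN, not_or]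
          exact ⟨fun h => Part.notMem_verts (p := .m) hn h hwv,
            fun h => Part.notMem_verts (p := .d) hn h hwv⟩
      obtain ⟨e, -, he⟩ := 𝓡.next (hV w (hN' hw)) hnotbag
      have hAZ : Disjoint Z (setA s n) := hZ.mono_right (setA_subset_verts hn)
      obtain ⟨P₂, d₂, hP₂, w₂, hw₂, hpos₂⟩ := exists_pos_setN hn (by omega) ⟨w, hw⟩ hN' (by omega) 𝓡
        hE hZ hZE hcard hi (P := 𝓡.bag d') (by
          rw [hbag]
          exact Finset.insert_subset_insert _ (Finset.union_subset_union_right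
            Finset.subset_union_left))
        (by
          intro hsub
          have ha : Vtx.a n 0 ∈ setA s n := mem_setA.2 ⟨_, by omega, rfl⟩
          have h := hsub ha
          rw [hbag] at h
          have := Finset.disjoint_right.1 hAZ ha
          simp [this, setN, setM, setD] at h) (hN' hw) he
      -- The guard grows by `s n + 1`, exactly the drop from `n` to `n'`, so the bound on the bags
      -- keeps its form.
      have hZ'card : (insert (Vtx.b n (f n)) (Z ∪ setA s n)).card = Z.card + s n + 1 := by
        rw [Finset.card_insert_of_notMem, Finset.card_union_of_disjoint hAZ, card_setA]
        rw [Finset.mem_union, not_or]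
        exact ⟨hZb _ hi, by simp [setA]⟩
      have hZ' : Disjoint (insert (Vtx.b n (f n)) (Z ∪ setA s n)) (verts s t (n - s n - 1)) := by
        rw [Finset.disjoint_insert_left, Finset.disjoint_union_left]
        exact ⟨Part.notMem_verts (p := .b) hn hbm, hZ.mono_right (verts_subset_verts hn),
          Finset.disjoint_left.2 fun x h => Part.notMem_verts (p := .a) hn h⟩
      obtain ⟨e, h1, h2, h3, h4⟩ := ih (n - s n - 1) (by omega) hn'
        (fun ℓ hℓ => hf ℓ (by rw [levels_of_le hn]; exact Finset.mem_insert_of_mem hℓ))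
        ((edges_subset_edges hn).trans hE) hZ' (by
          intro x hx z hz
          rcases Finset.mem_insert.1 hz with rfl | hz
          · exact hE' ((mem_edges hn).2 (by grind))
          · rcases Finset.mem_union.1 hz with hz | hz
            · exact hZE x (verts_subset_verts hn hx) z hz
            · exact hE' ((mem_edges hn).2 (by grind))) (by
          intro d
          rw [hZ'card]
          have := hcard d
          omega) hP₂ hw₂ hpos₂
      refine ⟨e, ?_, ?_, ?_, ?_⟩
      · exact (Finset.subset_union_left.trans (Finset.subset_insert _ _)).trans h1
      · refine h2.trans (Finset.union_subset (Finset.insert_subset (Finset.mem_union_right _ hbv)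
          (Finset.union_subset_union_right (setA_subset_verts hn)))
          ((verts_subset_verts hn).trans Finset.subset_union_right))
      · rw [h3, hZ'card]
        omega
      · intro ℓ hℓ j hj
        rw [levels_of_le hn, Finset.mem_insert] at hℓ
        rcases hℓ with rfl | hℓ
        -- The bag lies in the new guard together with `G_{n'}`, and this set meets `B(n)` only in
        -- the chosen vertex.
        · constructor
          · intro h
            have h5 := Part.notMem_verts (s := s) (t := t) (p := .b) (v := Vtx.b ℓ j) hn
              (mem_setB.2 ⟨_, hj, rfl⟩)
            have h6 := hZb j hj
            have h7 := h2 h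
            simpa [h5, h6, setA] using h7
          · rintro rfl
            exact h1 (Finset.mem_insert_self _ _)
        · exact h4 ℓ hℓ j hj

end LowerBound


/-! ### From a DAG decomposition to a pursuit -/

lemma DAGDecomposition.wellFounded_adj {V : Type} {G : Digraph V} (𝒟 : DAGDecomposition G) :
    WellFounded 𝒟.dag.Adj := by
  have : Std.Irrefl (Relation.TransGen 𝒟.dag.Adj) := ⟨𝒟.acyclic⟩
  have h := Finite.wellFounded_of_trans_of_irrefl (Relation.TransGen 𝒟.dag.Adj)
  exact Subrelation.wf Relation.TransGen.single h

lemma DAGDecomposition.wellFounded_adj_swap {V : Type} {G : Digraph V} (𝒟 : DAGDecomposition G) :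
    WellFounded fun e d => 𝒟.dag.Adj d e := by
  have : Std.Irrefl (Function.swap (Relation.TransGen 𝒟.dag.Adj)) := ⟨𝒟.acyclic⟩
  have h := Finite.wellFounded_of_trans_of_irrefl (Function.swap (Relation.TransGen 𝒟.dag.Adj))
  exact Subrelation.wf (fun h => Relation.TransGen.single h) h

/-- Climbing against the edges from a node whose bag contains `v` must stop, and it can stop only at
a root. -/
lemma DAGDecomposition.exists_root {V : Type} {G : Digraph V} (𝒟 : DAGDecomposition G) (v : V) :
    ∃ r, (∀ a, ¬ 𝒟.dag.Adj a r) ∧ v ∈ Below 𝒟.dag 𝒟.bag r := by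
  obtain ⟨d, hd⟩ := 𝒟.cover v
  have hv : v ∈ Below 𝒟.dag 𝒟.bag d := ⟨d, .refl, hd⟩
  clear hd
  induction d using 𝒟.wellFounded_adj.induction with
  | _ d ih =>
    by_cases h : ∃ a, 𝒟.dag.Adj a d
    · obtain ⟨a, ha⟩ := h
      obtain ⟨e, he, hve⟩ := hv
      exact ih a ha ⟨e, .head ha he, hve⟩
    · push Not at h
      exact ⟨d, h, hv⟩

section

variable {s t : ℕ → ℕ} {n : ℕ}

/-- The pursuit that a DAG decomposition of `G_n` gives. -/
def DAGDecomposition.pursuit (𝒟 : DAGDecomposition (graph s t n)) :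
    Pursuit Vtx 𝒟.Node (edges s t n) where
  bag d := (𝒟.bag d).map (Function.Embedding.subtype _)
  child d e := 𝒟.dag.Adj d e
  wf := 𝒟.wellFounded_adj_swap
  -- `Q` stands for the bag of a predecessor, or for `∅` at a root; the closure condition is then
  -- `edge_guarded` or `root_closed`.
  Pos P d u := ∃ Q : Finset {v // v ∈ verts s t n}, P = Q.map (Function.Embedding.subtype _) ∧
    reach (graph s t n) ((Q : Set _) ∩ 𝒟.bag d) (Below 𝒟.dag 𝒟.bag d \ Q) =
      Below 𝒟.dag 𝒟.bag d \ Q ∧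
    ∃ v : {v // v ∈ verts s t n}, v.1 = u ∧ v ∈ Below 𝒟.dag 𝒟.bag d \ Q
  notMem := by
    rintro P d u ⟨Q, rfl, -, v, rfl, hv⟩
    simpa using hv.2
  step := by
    rintro P d u v ⟨Q, rfl, hQ, u, rfl, hu⟩ huv hv
    refine ⟨Q, rfl, hQ, ⟨v, (mem_verts_of_mem_edges huv).2⟩, rfl, ?_⟩
    rw [← hQ]
    refine ⟨u, hu, fun h => hu.2 h.1, .single ⟨huv, fun h => hu.2 h.1, fun h => ?_⟩⟩
    refine hv ?_ ?_ <;> simp only [Finset.mem_map, Function.Embedding.subtype_apply]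
    · exact ⟨_, h.1, rfl⟩
    · exact ⟨_, h.2, rfl⟩
  next := by
    rintro P d u ⟨Q, rfl, -, u, rfl, ⟨c, hdc, huc⟩, -⟩ hud
    have hud' : u ∉ 𝒟.bag d := fun h => hud (Finset.mem_map.2 ⟨u, h, rfl⟩)
    rcases Relation.ReflTransGen.cases_head hdc with rfl | ⟨e, hde, hec⟩
    · exact absurd huc hud'
    · exact ⟨e, hde, 𝒟.bag d, rfl, 𝒟.edge_guarded d e hde, u, rfl, ⟨c, hec, huc⟩, hud'⟩

/-- For every choice of indices `f ℓ`, some bag of a DAG decomposition of width at most `n + 1` has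
`n + 1` vertices and meets each set `B(ℓ)` exactly in `b_{f ℓ}(ℓ)`. -/
lemma DAGDecomposition.exists_bag_of_choice
    (hs : ∀ n : ℕ, 5 ≤ n → 2 ≤ s n ∧ (s n : ℝ) < (n : ℝ) / Real.log n)
    (ht : ∀ n : ℕ, 5 ≤ n → 2 ≤ t n) (hn : 5 ≤ n) (𝒟 : DAGDecomposition (graph s t n))
    (hw : 𝒟.width ≤ n + 1) (f : ℕ → ℕ) (hf : ∀ ℓ ∈ levels s n, f ℓ < t ℓ) :
    ∃ e, (𝒟.bag e).card = n + 1 ∧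
      ∀ ℓ ∈ levels s n, ∀ j < t ℓ,
        Vtx.b ℓ j ∈ (𝒟.bag e).map (Function.Embedding.subtype _) ↔ j = f ℓ := by
  have hsn := three_mul_lt hs hn
  have hm : Vtx.m n 0 ∈ setN s n := mem_setN.2 (.inl (mem_setM.2 ⟨0, by omega, rfl⟩))
  obtain ⟨r, hr, hv⟩ := 𝒟.exists_root ⟨_, setN_subset_verts (t := t) hn hm⟩
  have hpos : 𝒟.pursuit.Pos ∅ r (Vtx.m n 0) := by
    refine ⟨∅, rfl, ?_, _, rfl, hv, by simp⟩
    have := 𝒟.root_closed r hr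
    simpa using this
  obtain ⟨e, -, -, h1, h2⟩ := DagWidth.exists_bag_of_choice hs ht 𝒟.pursuit f hn hf subset_rfl
    (Z := ∅) (by simp) (by simp) (fun d => by
      have h3 : (𝒟.bag d).card ≤ 𝒟.width :=
        Finset.le_sup (f := fun d => (𝒟.bag d).card) (Finset.mem_univ d)
      simpa [DAGDecomposition.pursuit] using h3.trans hw) (by simp) hm hpos
  exact ⟨e, by simpa [DAGDecomposition.pursuit] using h1, h2⟩

/-- Only widths up to `n + 1` need an argument, and there the robber forces a bag of size `n + 1`;
any choice of indices will do. -/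
lemma DAGDecomposition.le_width
    (hs : ∀ n : ℕ, 5 ≤ n → 2 ≤ s n ∧ (s n : ℝ) < (n : ℝ) / Real.log n)
    (ht : ∀ n : ℕ, 5 ≤ n → 2 ≤ t n) (hn : 5 ≤ n) (𝒟 : DAGDecomposition (graph s t n)) :
    n + 1 ≤ 𝒟.width := by
  rcases le_total 𝒟.width (n + 1) with hw | hw
  · obtain ⟨e, he, -⟩ := 𝒟.exists_bag_of_choice hs ht hn hw (fun _ => 0) (fun ℓ hℓ => by
      have := ht ℓ (le_of_mem_levels hℓ).1
      omega)
    rw [← he]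
    exact Finset.le_sup (f := fun d => (𝒟.bag d).card) (Finset.mem_univ e)
  · exact hw

/-- The choice of indices can be read off from the bag that realises it, so choices inject into
bags. -/
lemma DAGDecomposition.prod_le_numBags
    (hs : ∀ n : ℕ, 5 ≤ n → 2 ≤ s n ∧ (s n : ℝ) < (n : ℝ) / Real.log n)
    (ht : ∀ n : ℕ, 5 ≤ n → 2 ≤ t n) (hn : 5 ≤ n) (𝒟 : DAGDecomposition (graph s t n))
    (hw : 𝒟.width = n + 1) : ∏ ℓ ∈ levels s n, t ℓ ≤ 𝒟.numBags := by
  classical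
  have hchoice : ∀ g : (ℓ : ℕ) → ℓ ∈ levels s n → ℕ,
      g ∈ (levels s n).pi (fun ℓ => Finset.range (t ℓ)) → ∃ e, ∀ ℓ (hℓ : ℓ ∈ levels s n),
        ∀ j < t ℓ, Vtx.b ℓ j ∈ (𝒟.bag e).map (Function.Embedding.subtype _) ↔ j = g ℓ hℓ := by
    intro g hg
    rw [Finset.mem_pi] at hg
    obtain ⟨e, -, he⟩ := 𝒟.exists_bag_of_choice hs ht hn hw.le
      (fun ℓ => if h : ℓ ∈ levels s n then g ℓ h else 0) (fun ℓ hℓ => by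
        simpa [hℓ] using hg ℓ hℓ)
    refine ⟨e, fun ℓ hℓ j hj => ?_⟩
    simpa only [hℓ, dif_pos] using he ℓ hℓ j hj
  have hsn := three_mul_lt hs hn
  have : Nonempty 𝒟.Node := by
    obtain ⟨d, -⟩ := 𝒟.cover ⟨Vtx.m n 0, setN_subset_verts hn
      (mem_setN.2 (.inl (mem_setM.2 ⟨0, by omega, rfl⟩)))⟩
    exact ⟨d⟩
  choose! node hnode using hchoice
  have hcard : ((levels s n).pi fun ℓ => Finset.range (t ℓ)).card = ∏ ℓ ∈ levels s n, t ℓ := by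
    simp [Finset.card_pi]
  rw [← hcard, DAGDecomposition.numBags,
    Set.ncard_eq_toFinset_card (Set.range 𝒟.bag) (Set.toFinite _)]
  refine Finset.card_le_card_of_injOn (fun g => 𝒟.bag (node g)) (fun g _ => by simp) ?_
  intro g hg g' hg' h
  have hg := Finset.mem_coe.1 hg
  have hg' := Finset.mem_coe.1 hg'
  funext ℓ hℓ
  have hlt := Finset.mem_range.1 (Finset.mem_pi.1 hg ℓ hℓ)
  have h1 := (hnode g hg ℓ hℓ _ hlt).2 rfl
  have h' : 𝒟.bag (node g) = 𝒟.bag (node g') := h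
  rw [h'] at h1
  exact (hnode g' hg' ℓ hℓ _ hlt).1 h1

end


/-! ### From a cop strategy to a DAG decomposition -/

/-- `Win G k S R`: if `k` cops occupy part of the set `S` and the robber is in the territory `R`,
then the cops can catch the robber without ever enlarging his territory. -/
inductive Win {V : Type} [DecidableEq V] (G : Digraph V) (k : ℕ) : Finset V → Set V → Prop
  | step {S : Finset V} {R : Set V} (X : Finset V) (card_le : X.card ≤ k)
      (subset : ∀ x ∈ X, x ∈ S ∨ x ∈ R) (disj : ∀ x ∈ S, x ∉ R)
      (closed : ∀ u ∈ R, ∀ v, G.Adj u v → (v ∈ S → v ∉ X) → v ∈ R)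
      (T : V → Set V) (mem : ∀ v ∈ R, v ∉ X → v ∈ T v)
      (sub : ∀ v ∈ R, v ∉ X → ∀ w ∈ T v, w ∈ R ∧ w ∉ X)
      (win : ∀ v ∈ R, v ∉ X → Win G k X (T v)) : Win G k S R

/-- A move of the cops after which the robber chooses his new territory. -/
lemma Win.move {V : Type} [DecidableEq V] {G : Digraph V} {k : ℕ} {S : Finset V} {R : Set V}
    (X : Finset V) (card_le : X.card ≤ k) (subset : ∀ x ∈ X, x ∈ S ∨ x ∈ R)
    (disj : ∀ x ∈ S, x ∉ R) (closed : ∀ u ∈ R, ∀ v, G.Adj u v → (v ∈ S → v ∉ X) → v ∈ R)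
    (h : ∀ v ∈ R, v ∉ X → ∃ T : Set V, v ∈ T ∧ (∀ w ∈ T, w ∈ R ∧ w ∉ X) ∧ Win G k X T) :
    Win G k S R := by
  choose! T h1 h2 h3 using h
  exact .step X card_le subset disj closed T h1 h2 h3

lemma reach_eq_self {V : Type} {G : Digraph V} {S X : Set V} (hdisj : ∀ x ∈ X, x ∉ S)
    (h : ∀ u ∈ X, ∀ v, G.Adj u v → v ∉ S → v ∈ X) : reach G S X = X := by
  ext v
  constructor
  · rintro ⟨u, hu, -, huv⟩
    induction huv with
    | refl => exact hu
    | tail _ h1 ih => exact h _ ih _ h1.1 h1.2.2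
  · intro hv
    exact ⟨v, hv, hdisj v hv, .refl⟩

/-- A part of a DAG decomposition with one root that decomposes the territory `R` under the guard
of `S`. -/
structure RootedDecomposition {V : Type} (G : Digraph V) (k : ℕ) (S : Finset V) (R : Set V) where
  Node : Type
  [fintypeNode : Fintype Node]
  dag : Digraph Node
  bag : Node → Finset V
  root : Node
  acyclic : ∀ d, ¬ Relation.TransGen dag.Adj d d
  reach_root : ∀ d, Relation.ReflTransGen dag.Adj root d
  card_le : ∀ d, (bag d).card ≤ k
  bag_subset : ∀ d, ∀ v ∈ bag d, v ∈ S ∨ v ∈ R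
  disj : ∀ x ∈ S, x ∉ R
  cover : ∀ v ∈ R, ∃ d, v ∈ bag d
  -- `S` acts as a bag above the root: this field and `root_guarded` become connectivity and
  -- guarding at the new root when decompositions are glued.
  guard_connected : ∀ b c, Relation.ReflTransGen dag.Adj b c → ∀ v, v ∈ S → v ∈ bag c → v ∈ bag b
  connected : ∀ a b c, Relation.TransGen dag.Adj a b → Relation.TransGen dag.Adj b c →
    ∀ v, v ∈ bag a → v ∈ bag c → v ∈ bag b
  root_guarded : ∀ u ∈ R, ∀ v, G.Adj u v → (v ∈ S → v ∉ bag root) → v ∈ R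
  edge_guarded : ∀ a b, dag.Adj a b →
    reach G ((bag a : Set V) ∩ bag b) (Below dag bag b \ bag a) = Below dag bag b \ bag a

namespace RootedDecomposition

variable {V : Type} {G : Digraph V} {k : ℕ}

attribute [instance] RootedDecomposition.fintypeNode

section Glue

variable {ι : Type} {X : Finset V} {R : ι → Set V}
  (𝒟 : ∀ i, RootedDecomposition G k X (R i))

/-- The edges of the DAG that joins a family of DAGs with roots below a new root. -/
def glueAdj : Option (Σ i, (𝒟 i).Node) → Option (Σ i, (𝒟 i).Node) → Prop
  | none, none => False
  | none, some ⟨i, d⟩ => d = (𝒟 i).root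
  | some _, none => False
  | some ⟨i, d⟩, some y => ∃ e, y = ⟨i, e⟩ ∧ (𝒟 i).dag.Adj d e

/-- The bags of the DAG that joins a family of DAGs with roots below a new root. -/
def glueBag : Option (Σ i, (𝒟 i).Node) → Finset V
  | none => X
  | some ⟨i, d⟩ => (𝒟 i).bag d

/-- No edge leaves a component, so everything below one of its nodes stays inside it. -/
lemma glue_reflTransGen_some {i : ι} {d : (𝒟 i).Node} {y : Option (Σ i, (𝒟 i).Node)}
    (h : Relation.ReflTransGen (glueAdj 𝒟) (some ⟨i, d⟩) y) :
    ∃ e, y = some ⟨i, e⟩ ∧ Relation.ReflTransGen (𝒟 i).dag.Adj d e := by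
  induction h with
  | refl => exact ⟨d, rfl, .refl⟩
  | @tail y z _ h1 ih =>
    obtain ⟨e, rfl, he⟩ := ih
    rcases z with _ | ⟨j, z⟩
    · exact h1.elim
    · obtain ⟨e', h2, h3⟩ := h1
      exact ⟨e', by rw [h2], he.tail h3⟩

lemma glue_transGen_some {i : ι} {d : (𝒟 i).Node} {y : Option (Σ i, (𝒟 i).Node)}
    (h : Relation.TransGen (glueAdj 𝒟) (some ⟨i, d⟩) y) :
    ∃ e, y = some ⟨i, e⟩ ∧ Relation.TransGen (𝒟 i).dag.Adj d e := by
  obtain ⟨z, h1, h2⟩ := Relation.TransGen.head'_iff.1 h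
  rcases z with _ | ⟨j, z⟩
  · exact h1.elim
  · obtain ⟨e', h3, h4⟩ := h1
    rw [h3] at h2
    obtain ⟨e, rfl, he⟩ := glue_reflTransGen_some 𝒟 h2
    exact ⟨e, rfl, .head' h4 he⟩

lemma glue_reflTransGen_lift {i : ι} {d e : (𝒟 i).Node}
    (h : Relation.ReflTransGen (𝒟 i).dag.Adj d e) :
    Relation.ReflTransGen (glueAdj 𝒟) (some ⟨i, d⟩) (some ⟨i, e⟩) := by
  induction h with
  | refl => exact .refl
  | @tail b c _ h1 ih => exact ih.tail ⟨c, rfl, h1⟩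

lemma glue_not_adj_none (x : Option (Σ i, (𝒟 i).Node)) : ¬ glueAdj 𝒟 x none := by
  rcases x with _ | ⟨i, d⟩ <;> exact id

lemma glue_not_transGen_none (x : Option (Σ i, (𝒟 i).Node)) :
    ¬ Relation.TransGen (glueAdj 𝒟) x none := by
  intro h
  obtain ⟨z, -, h1⟩ := Relation.TransGen.tail'_iff.1 h
  exact glue_not_adj_none 𝒟 z h1

lemma glue_below_some {i : ι} {d : (𝒟 i).Node} :
    Below ⟨glueAdj 𝒟⟩ (glueBag 𝒟) (some ⟨i, d⟩) = Below (𝒟 i).dag (𝒟 i).bag d := by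
  ext v
  constructor
  · rintro ⟨y, hy, hv⟩
    obtain ⟨e, rfl, he⟩ := glue_reflTransGen_some 𝒟 hy
    exact ⟨e, he, hv⟩
  · rintro ⟨e, he, hv⟩
    exact ⟨some ⟨i, e⟩, glue_reflTransGen_lift 𝒟 he, hv⟩

end Glue

/-- Identifies the set in the guarding condition for the edge from a new root with bag `S`. -/
lemma below_root_diff {S : Finset V} {R : Set V} (𝒟 : RootedDecomposition G k S R) :
    Below 𝒟.dag 𝒟.bag 𝒟.root \ S = R := by
  ext v
  constructor
  · rintro ⟨⟨d, -, hv⟩, hvS⟩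
    exact (𝒟.bag_subset d v hv).resolve_left hvS
  · intro hv
    obtain ⟨d, hd⟩ := 𝒟.cover v hv
    exact ⟨⟨d, 𝒟.reach_root d, hd⟩, fun h => 𝒟.disj v h hv⟩

end RootedDecomposition

-- Induction along the strategy: the new root gets the bag `X`, and below it hangs, for each robber
-- position `v ∈ R \ X`, a decomposition of `T v` guarded by `X`.
open RootedDecomposition in
lemma Win.nonempty_rootedDecomposition {V : Type} [Fintype V] [DecidableEq V] {G : Digraph V}
    {k : ℕ} {S : Finset V} {R : Set V} (h : Win G k S R) :
    Nonempty (RootedDecomposition G k S R) := by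
  classical
  induction h with
  | @step S R X card_le subset disj closed T mem sub win ih =>
    let ι : Type := {v : V // v ∈ R ∧ v ∉ X}
    have 𝒟 : ∀ i : ι, RootedDecomposition G k X (T i.1) := fun i =>
      Classical.choice (ih i.1 i.2.1 i.2.2)
    have hR : ∀ i : ι, ∀ v ∈ T i.1, v ∈ R := fun i v hv => (sub i.1 i.2.1 i.2.2 v hv).1
    have hsub : ∀ (i : ι) d, ∀ v ∈ (𝒟 i).bag d, v ∈ S ∨ v ∈ R := by
      intro i d v hv
      rcases (𝒟 i).bag_subset d v hv with h | h
      · exact subset v h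
      · exact .inr (hR i v h)
    have hguard : ∀ (i : ι) b c, Relation.ReflTransGen (𝒟 i).dag.Adj b c →
        ∀ v, v ∈ S → v ∈ (𝒟 i).bag c → v ∈ X ∧ v ∈ (𝒟 i).bag b := by
      intro i b c hbc v hvS hvc
      rcases (𝒟 i).bag_subset c v hvc with h | h
      · exact ⟨h, (𝒟 i).guard_connected b c hbc v h hvc⟩
      · exact absurd (hR i v h) (disj v hvS)
    exact ⟨{
      Node := Option (Σ i, (𝒟 i).Node)
      dag := ⟨glueAdj 𝒟⟩
      bag := glueBag 𝒟
      root := none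
      acyclic := by
        rintro (_ | ⟨i, d⟩) h
        · exact glue_not_transGen_none 𝒟 _ h
        · obtain ⟨e, h1, h2⟩ := glue_transGen_some 𝒟 h
          simp only [Option.some.injEq, Sigma.mk.injEq, heq_eq_eq, true_and] at h1
          subst h1
          exact (𝒟 i).acyclic _ h2
      reach_root := by
        rintro (_ | ⟨i, d⟩)
        · exact .refl
        · have h : glueAdj 𝒟 none (some ⟨i, (𝒟 i).root⟩) := rfl
          exact .head h (glue_reflTransGen_lift 𝒟 ((𝒟 i).reach_root d))
      card_le := by
        rintro (_ | ⟨i, d⟩)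
        · exact card_le
        · exact (𝒟 i).card_le d
      bag_subset := by
        rintro (_ | ⟨i, d⟩)
        · exact subset
        · exact hsub i d
      disj := disj
      cover := by
        intro v hv
        by_cases hvX : v ∈ X
        · exact ⟨none, hvX⟩
        · obtain ⟨d, hd⟩ := (𝒟 ⟨v, hv, hvX⟩).cover v (mem v hv hvX)
          exact ⟨some ⟨_, d⟩, hd⟩
      guard_connected := by
        rintro (_ | ⟨i, b⟩) c hbc v hvS hvc
        · rcases c with _ | ⟨j, c⟩
          · exact hvc
          · exact (hguard j c c .refl v hvS hvc).1
        · obtain ⟨e, rfl, he⟩ := glue_reflTransGen_some 𝒟 hbc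
          exact (hguard i b e he v hvS hvc).2
      connected := by
        rintro (_ | ⟨i, a⟩) b c hab hbc v hva hvc
        · rcases b with _ | ⟨j, b⟩
          · exact absurd hab (glue_not_transGen_none 𝒟 _)
          · obtain ⟨e, rfl, he⟩ := glue_transGen_some 𝒟 hbc
            exact (𝒟 j).guard_connected b e he.to_reflTransGen v hva hvc
        · obtain ⟨b, rfl, hb⟩ := glue_transGen_some 𝒟 hab
          obtain ⟨c, rfl, hc⟩ := glue_transGen_some 𝒟 hbc
          exact (𝒟 i).connected a b c hb hc v hva hvc
      root_guarded := closed
      edge_guarded := by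
        rintro (_ | ⟨i, a⟩) (_ | ⟨j, b⟩) hab
        · exact hab.elim
        · have hb : b = (𝒟 j).root := hab
          subst hb
          have h1 : Below ⟨glueAdj 𝒟⟩ (glueBag 𝒟) (some ⟨j, (𝒟 j).root⟩) \
              (glueBag 𝒟 none : Set V) = T j.1 := by
            rw [glue_below_some]
            exact (𝒟 j).below_root_diff
          rw [h1]
          refine reach_eq_self (fun x hx h => (𝒟 j).disj x h.1 hx) fun u hu v huv hv => ?_
          exact (𝒟 j).root_guarded u hu v huv fun h1 h2 => hv ⟨h1, h2⟩
        · exact hab.elim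
        · obtain ⟨e, h1, h2⟩ := hab
          cases h1
          rw [glue_below_some]
          exact (𝒟 i).edge_guarded a e h2 }⟩

lemma Win.exists_dagDecomposition {V : Type} [Fintype V] [DecidableEq V] {G : Digraph V} {k : ℕ}
    (h : Win G k ∅ Set.univ) : ∃ 𝒟 : DAGDecomposition G, 𝒟.width ≤ k := by
  obtain ⟨𝒯⟩ := h.nonempty_rootedDecomposition
  refine ⟨{
    Node := 𝒯.Node
    dag := 𝒯.dag
    bag := 𝒯.bag
    acyclic := 𝒯.acyclic
    cover := fun v => 𝒯.cover v trivial
    connected := 𝒯.connected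
    root_closed := ?_
    edge_guarded := 𝒯.edge_guarded }, Finset.sup_le fun d _ => 𝒯.card_le d⟩
  intro r hr
  have hroot : r = 𝒯.root := by
    rcases Relation.ReflTransGen.cases_tail (𝒯.reach_root r) with h | ⟨c, -, h⟩
    · exact h
    · exact absurd h (hr c)
  have huniv : Below 𝒯.dag 𝒯.bag r = Set.univ := by
    rw [hroot]
    have := 𝒯.below_root_diff
    simpa using this
  rw [huniv]
  exact reach_eq_self (fun _ _ h => h) fun _ _ _ _ _ => trivial


/-- Lets the strategy be built on all vertex names and then restricted to the vertices of `G_n`. -/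
lemma Win.comap {V : Type} [DecidableEq V] {G : Digraph V} {k : ℕ} {S : Finset V} {R : Set V}
    (h : Win G k S R) (p : V → Prop) [DecidablePred p] :
    Win (⟨fun x y => G.Adj x.1 y.1⟩ : Digraph {v // p v}) k (S.subtype p) (Subtype.val ⁻¹' R) := by
  induction h with
  | @step S R X card_le subset disj closed T mem sub win ih =>
    refine .step (X.subtype p) ?_ ?_ ?_ ?_ (fun v => Subtype.val ⁻¹' T v.1) ?_ ?_ ?_
    · rw [Finset.card_subtype]
      exact (Finset.card_filter_le _ _).trans card_le
    · intro x hx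
      simpa using subset x (by simpa using hx)
    · intro x hx
      exact disj x (by simpa using hx)
    · intro u hu v huv hv
      exact closed u hu v huv (by simpa using hv)
    · intro v hv hvX
      exact mem v hv (by simpa using hvX)
    · intro v hv hvX w hw
      simpa using sub v hv (by simpa using hvX) w hw
    · intro v hv hvX
      exact ih v hv (by simpa using hvX)

/-! ### The cops' strategy -/

section Strategy

section Abstract

variable {α : Type} [DecidableEq α] {G : Digraph α} {k : ℕ} {Z M D A B C V : Finset α} {Q : Set α}
  {b : α} {part : α → ℕ}

/-- The cops in `Z`, `A` and at `b` catch a robber in the remaining part of `B`. -/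
lemma win_of_subset_setB (hQ : ∀ x ∈ Q, part x = 1) (hB : ∀ x ∈ B, part x = 5) (hb : b ∈ B)
    (eQ : ∀ u ∈ Q, ∀ v, G.Adj u v → v ∈ Z ∨ v ∈ Q)
    (eB : ∀ u ∈ B, ∀ v, G.Adj u v → v ∈ A ∨ v ∈ Z ∨ v ∈ Q)
    (hcard : (insert b (Z ∪ A)).card + 1 ≤ k)
    (hQW : ∀ X : Finset α, Z ⊆ X → (∀ x ∈ X, x ∉ Q) → Win G k X Q)
    {X : Finset α} (hX : insert b (Z ∪ A) ⊆ X)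
    (hXQ : ∀ x ∈ X, x ∉ {x | (x ∈ B ∧ x ≠ b) ∨ x ∈ Q}) :
    Win G k X {x | (x ∈ B ∧ x ≠ b) ∨ x ∈ Q} := by
  have hX' : ∀ x, x = b ∨ x ∈ Z ∨ x ∈ A → x ∈ X := fun x hx => hX (by
    simpa only [Finset.mem_insert, Finset.mem_union] using hx)
  simp only [Set.mem_ofPred_eq] at hXQ
  refine Win.move (insert b (Z ∪ A)) (by omega) ?_ ?_ ?_ ?_ <;>
    simp only [Set.mem_ofPred_eq, Finset.mem_insert, Finset.mem_union]
  · clear hQW; grind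
  · clear hQW; grind
  · clear hQW; grind
  intro v hv hvX
  by_cases hvQ : v ∈ Q
  · refine ⟨Q, hvQ, ?_, hQW _ ?_ ?_⟩
    · clear hQW; grind
    · exact Finset.subset_union_left.trans (Finset.subset_insert _ _)
    · clear hQW; grind
  have hv' : v ∈ B ∧ v ≠ b := hv.resolve_right hvQ
  refine ⟨{x | x = v ∨ x ∈ Q}, .inl rfl, ?_, ?_⟩
  · clear hQW; simp only [Set.mem_ofPred_eq]; grind
  -- `B` has no inner edges and its exits into `A` are held, so one more cop on `v` leaves the
  -- robber only `Q`.
  refine Win.move (insert v (insert b (Z ∪ A))) ((Finset.card_insert_le _ _).trans hcard)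
    ?_ ?_ ?_ ?_ <;> simp only [Set.mem_ofPred_eq, Finset.mem_insert, Finset.mem_union]
  · clear hQW; grind
  · clear hQW; grind
  · clear hQW; grind
  intro w hw hwX
  refine ⟨Q, ?_, ?_, hQW _ ?_ ?_⟩
  · clear hQW; grind
  · clear hQW; grind
  · exact Finset.subset_union_left.trans
      ((Finset.subset_insert _ _).trans (Finset.subset_insert _ _))
  · clear hQW; grind

/-- The cops in `Z`, `M` and `D` catch a robber with access to a single set `C`, provided that they
win against a robber in `V`. -/
lemma win_of_guard (hZ : ∀ x ∈ Z, part x = 0) (hQ : ∀ x ∈ Q, part x = 1)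
    (hM : ∀ x ∈ M, part x = 2) (hD : ∀ x ∈ D, part x = 3)
    (hA : ∀ x ∈ A, part x = 4) (hB : ∀ x ∈ B, part x = 5) (hC : ∀ x ∈ C, part x = 6)
    (hV : ∀ x ∈ V, part x = 7) (hb : b ∈ B)
    (eQ : ∀ u ∈ Q, ∀ v, G.Adj u v → v ∈ Z ∨ v ∈ Q)
    (eA : ∀ u ∈ A, ∀ v, G.Adj u v → (v ∈ A ∨ v ∈ B ∨ v ∈ M ∨ v ∈ V) ∨ v ∈ Z ∨ v ∈ Q)
    (eB : ∀ u ∈ B, ∀ v, G.Adj u v → v ∈ A ∨ v ∈ Z ∨ v ∈ Q)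
    (eC : ∀ u ∈ C, ∀ v, G.Adj u v → (v ∈ C ∨ v ∈ D ∨ v = b) ∨ v ∈ Z ∨ v ∈ Q)
    (eV : ∀ u ∈ V, ∀ v, G.Adj u v → (v ∈ V ∨ v ∈ A ∨ v ∈ B) ∨ v ∈ Z ∨ v ∈ Q)
    (hcard : (insert b (Z ∪ (M ∪ D))).card ≤ k) (hcardC : (insert b (Z ∪ D ∪ C)).card ≤ k)
    (hcardA : (insert b (Z ∪ M ∪ A)).card ≤ k)
    (hQW : ∀ X : Finset α, Z ⊆ X → (∀ x ∈ X, x ∉ Q) → Win G k X Q)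
    (hVW : Win G k (insert b (Z ∪ M ∪ A)) {x | x ∈ V ∨ x ∈ {x | (x ∈ B ∧ x ≠ b) ∨ x ∈ Q}}) :
    Win G k (Z ∪ (M ∪ D)) {x | x ∈ C ∨ x ∈ B ∨ x ∈ A ∨ x ∈ V ∨ x ∈ Q} := by
  refine Win.move (insert b (Z ∪ (M ∪ D))) hcard ?_ ?_ ?_ ?_ <;>
    simp only [Set.mem_ofPred_eq, Finset.mem_insert, Finset.mem_union]
  · clear hQW hVW; grind
  · clear hQW hVW; grind
  · clear hQW hVW; grind
  intro v hv hvX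
  by_cases hvC : v ∈ C
  · refine ⟨{x | x ∈ C ∨ x ∈ Q}, .inl hvC, ?_, ?_⟩
    · clear hQW hVW; simp only [Set.mem_ofPred_eq]; grind
    -- `D` and `b` hold the exits of `C`, so the cops on `M` are free to fill it.
    refine Win.move (insert b (Z ∪ D ∪ C)) hcardC ?_ ?_ ?_ ?_ <;>
      simp only [Set.mem_ofPred_eq, Finset.mem_insert, Finset.mem_union]
    · clear hQW hVW; grind
    · clear hQW hVW; grind
    · clear hQW hVW; grind
    intro v hv hvX
    refine ⟨Q, ?_, ?_, hQW _ ?_ ?_⟩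
    · clear hQW hVW; grind
    · clear hQW hVW; grind
    · exact Finset.subset_union_left.trans
        (Finset.subset_union_left.trans (Finset.subset_insert _ _))
    · clear hQW hVW; grind
  · refine ⟨{x | (x ∈ B ∧ x ≠ b) ∨ x ∈ A ∨ x ∈ V ∨ x ∈ Q}, ?_, ?_, ?_⟩
    · clear hQW hVW; simp only [Set.mem_ofPred_eq]; grind
    · clear hQW hVW; simp only [Set.mem_ofPred_eq]; grind
    -- No edge leads from `A`, `B` or `V` to `D`, so the cops on `D` are free to fill `A`.
    refine Win.move (insert b (Z ∪ M ∪ A)) hcardA ?_ ?_ ?_ ?_ <;>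
      simp only [Set.mem_ofPred_eq, Finset.mem_insert, Finset.mem_union]
    · clear hQW hVW; grind
    · clear hQW hVW; grind
    · clear hQW hVW; grind
    intro v hv hvX
    refine ⟨_, ?_, ?_, hVW⟩ <;> clear hQW hVW <;> simp only [Set.mem_ofPred_eq] <;> grind

end Abstract

variable {s t : ℕ → ℕ} {E : Finset (Vtx × Vtx)} {k : ℕ}

/-- The cops catch the robber in `G_n` when he can leave `G_n` only through the guard `Z` or
into a territory `Q` in which he gets caught. -/
lemma win_verts (hs : ∀ n : ℕ, 5 ≤ n → 3 * s n < 2 * n) (ht : ∀ n : ℕ, 5 ≤ n → 0 < t n) :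
    ∀ {n : ℕ} {Z : Finset Vtx} {Q : Set Vtx}, (∀ z ∈ Z, z ∉ verts s t n) →
    (∀ q ∈ Q, q ∉ verts s t n) → (∀ z ∈ Z, z ∉ Q) →
    (∀ u ∈ verts s t n, ∀ v, (u, v) ∈ E → (u, v) ∈ edges s t n ∨ v ∈ Z ∨ v ∈ Q) →
    (∀ u ∈ Q, ∀ v, (u, v) ∈ E → v ∈ Z ∨ v ∈ Q) →
    (∀ X : Finset Vtx, Z ⊆ X → (∀ x ∈ X, x ∉ Q) → Win ⟨fun u v => (u, v) ∈ E⟩ k X Q) →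
    Z.card + n + 1 ≤ k → ∀ X : Finset Vtx, Z ⊆ X → (∀ x ∈ X, x ∉ verts s t n ∧ x ∉ Q) →
    Win ⟨fun u v => (u, v) ∈ E⟩ k X {v | v ∈ verts s t n ∨ v ∈ Q} := by
  intro n
  induction n using Nat.strong_induction_on with
  | _ n ih =>
    intro Z Q hZ hQ hZQ hE hQE hQW hk X hZX hX
    have hEv : ∀ u ∈ verts s t n, ∀ v, (u, v) ∈ E → v ∈ verts s t n ∨ v ∈ Z ∨ v ∈ Q := by
      intro u hu v huv
      rcases hE u hu v huv with h | h
      · exact .inl (mem_verts_of_mem_edges h).2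
      · exact .inr h
    rcases lt_or_ge n 5 with hn | hn
    · rw [verts_of_lt hn] at *
      refine Win.move (insert Vtx.bot Z) ?_ ?_ ?_ ?_ ?_
      · exact (Finset.card_insert_le _ _).trans (by omega)
      · simp only [Set.mem_ofPred_eq]; grind
      · simp only [Set.mem_ofPred_eq]; grind
      · simp only [Set.mem_ofPred_eq]; grind
      · intro v hv hvX
        exact ⟨Q, by simp only [Set.mem_ofPred_eq] at hv; grind,
          by simp only [Set.mem_ofPred_eq]; grind, hQW _ (Finset.subset_insert _ _) (by grind)⟩
    have hsn := hs n hn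
    have htn := ht n hn
    have hV : ∀ x, x ∈ verts s t n ↔ x ∈ verts s t (n - s n - 1) ∨ x ∈ setA s n ∨ x ∈ setB t n ∨
      (∃ i < t n, x ∈ setC s n i) ∨ x ∈ setN s n := fun x => mem_verts hn
    -- the cops move to `N`, and the robber chooses some `i`
    have hcardN : (Z ∪ setN s n).card ≤ Z.card + n := by
      refine (Finset.card_union_le _ _).trans ?_
      rw [card_setN (by omega)]
    refine Win.move (Z ∪ setN s n) (by omega) ?_ ?_ ?_ ?_
    · simp only [Set.mem_ofPred_eq, Finset.mem_union]; clear ih hQW; grind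
    · simp only [Set.mem_ofPred_eq]; clear ih hQW; grind
    · simp only [Set.mem_ofPred_eq, Finset.mem_union]; clear ih hQW; grind
    intro v hv hvX
    have hi : ∃ i < t n, v ∈ {x | x ∈ setC s n i ∨ x ∈ setB t n ∨ x ∈ setA s n ∨
        x ∈ verts s t (n - s n - 1) ∨ x ∈ Q} := by
      by_cases h : ∃ i < t n, v ∈ setC s n i
      · obtain ⟨i, hi, hvi⟩ := h
        exact ⟨i, hi, .inl hvi⟩
      -- A robber outside all `C_i` cannot get into any of them, so the index is arbitrary.
      · refine ⟨0, htn, .inr ?_⟩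
        rw [Finset.mem_union, not_or] at hvX
        have h1 := hV v
        have h2 : v ∈ verts s t n ∨ v ∈ Q := hv
        change v ∈ setB t n ∨ v ∈ setA s n ∨ v ∈ verts s t (n - s n - 1) ∨ v ∈ Q
        rcases h2 with h2 | h2
        · rcases h1.1 h2 with h3 | h3 | h3 | h3 | h3
          · exact .inr (.inr (.inl h3))
          · exact .inr (.inl h3)
          · exact .inl h3
          · exact absurd h3 h
          · exact absurd h3 hvX.2
        · exact .inr (.inr (.inr h2))
    obtain ⟨i, hi, hvi⟩ := hi
    have hNX : ∀ p : Part, p ≠ .m → p ≠ .d → ∀ x ∈ p.toFinset s t n, x ∉ setN s n := by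
      intro p h1 h2 x hx hxN
      rcases mem_setN.1 hxN with h | h
      · exact h1 (Part.eq_of_mem (q := .m) hx h)
      · exact h2 (Part.eq_of_mem (q := .d) hx h)
    have hVN : ∀ x ∈ verts s t (n - s n - 1), x ∉ setN s n := by
      intro x hx hxN
      rcases mem_setN.1 hxN with h | h
      · exact Part.notMem_verts (p := .m) hn h hx
      · exact Part.notMem_verts (p := .d) hn h hx
    refine ⟨_, hvi, ?_, ?_⟩
    · have hCN := hNX (.c i) (by simp) (by simp)
      have hBN := hNX .b (by simp) (by simp)
      have hAN := hNX .a (by simp) (by simp)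
      simp only [Part.toFinset] at hCN hBN hAN
      have hNV : ∀ x ∈ setN s n, x ∈ verts s t n := fun x hx => setN_subset_verts hn hx
      simp only [Set.mem_ofPred_eq, Finset.mem_union]
      rintro w (h | h | h | h | h)
      · have hw : w ∈ verts s t n := setC_subset_verts hn hi h
        exact ⟨.inl hw, fun h' => h'.elim (fun h' => hZ w h' hw) (hCN w h)⟩
      · have hw : w ∈ verts s t n := setB_subset_verts hn h
        exact ⟨.inl hw, fun h' => h'.elim (fun h' => hZ w h' hw) (hBN w h)⟩
      · have hw : w ∈ verts s t n := setA_subset_verts hn h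
        exact ⟨.inl hw, fun h' => h'.elim (fun h' => hZ w h' hw) (hAN w h)⟩
      · have hw : w ∈ verts s t n := verts_subset_verts hn h
        exact ⟨.inl hw, fun h' => h'.elim (fun h' => hZ w h' hw) (hVN w h)⟩
      · exact ⟨.inr h, fun h' => h'.elim (fun h' => hZQ w h' h) (fun h' => hQ w h (hNV w h'))⟩
    clear hvi hvX hv v
    classical
    -- Distinct labels express that all the sets in play are pairwise disjoint.
    let part : Vtx → ℕ := fun x => if x ∈ Z then 0 else if x ∈ Q then 1 else
      if x ∈ verts s t (n - s n - 1) then 7 else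
      match x.part with
      | some .m => 2
      | some .d => 3
      | some .a => 4
      | some .b => 5
      | some (.c _) => 6
      | none => 8
    have pZ : ∀ x ∈ Z, part x = 0 := fun x hx => if_pos hx
    have pQ : ∀ x ∈ Q, part x = 1 := fun x hx => by
      have h1 : x ∉ Z := fun h => hZQ x h hx
      simp [part, h1, hx]
    have pV : ∀ x ∈ verts s t (n - s n - 1), part x = 7 := fun x hx => by
      have h1 : x ∉ Z := fun h => hZ x h (verts_subset_verts hn hx)
      have h2 : x ∉ Q := fun h => hQ x h (verts_subset_verts hn hx)
      simp [part, h1, h2, hx]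
    have pP : ∀ p : Part, p.toFinset s t n ⊆ verts s t n → ∀ x ∈ p.toFinset s t n,
        x ∉ Z ∧ x ∉ Q ∧ x ∉ verts s t (n - s n - 1) ∧ x.part = some p := fun p hp x hx =>
      ⟨fun h => hZ x h (hp hx), fun h => hQ x h (hp hx), Part.notMem_verts hn hx,
        (Part.level_eq hx).2⟩
    have pM : ∀ x ∈ setM s n, part x = 2 := fun x hx => by
      obtain ⟨h1, h2, h3, h4⟩ := pP .m
        (fun y hy => setN_subset_verts hn (mem_setN.2 (.inl hy))) x hx
      simp [part, h1, h2, h3, h4]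
    have pD : ∀ x ∈ setD s n, part x = 3 := fun x hx => by
      obtain ⟨h1, h2, h3, h4⟩ := pP .d
        (fun y hy => setN_subset_verts hn (mem_setN.2 (.inr hy))) x hx
      simp [part, h1, h2, h3, h4]
    have pA : ∀ x ∈ setA s n, part x = 4 := fun x hx => by
      obtain ⟨h1, h2, h3, h4⟩ := pP .a (setA_subset_verts hn) x hx
      simp [part, h1, h2, h3, h4]
    have pB : ∀ x ∈ setB t n, part x = 5 := fun x hx => by
      obtain ⟨h1, h2, h3, h4⟩ := pP .b (setB_subset_verts hn) x hx
      simp [part, h1, h2, h3, h4]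
    have pC : ∀ x ∈ setC s n i, part x = 6 := fun x hx => by
      obtain ⟨h1, h2, h3, h4⟩ := pP (.c i) (setC_subset_verts hn hi) x hx
      simp [part, h1, h2, h3, h4]
    clear_value part
    have hb : Vtx.b n i ∈ setB t n := mem_setB.2 ⟨_, hi, rfl⟩
    have eA : ∀ u ∈ setA s n, ∀ v, (u, v) ∈ E → (v ∈ setA s n ∨ v ∈ setB t n ∨ v ∈ setM s n ∨
        v ∈ verts s t (n - s n - 1)) ∨ v ∈ Z ∨ v ∈ Q := fun u hu v huv =>
      (hE u (setA_subset_verts hn hu) v huv).imp_left (edges_from_setA hn hu)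
    have eB : ∀ u ∈ setB t n, ∀ v, (u, v) ∈ E → v ∈ setA s n ∨ v ∈ Z ∨ v ∈ Q := fun u hu v huv =>
      (hE u (setB_subset_verts hn hu) v huv).imp_left (edges_from_setB hn hu)
    have eC : ∀ u ∈ setC s n i, ∀ v, (u, v) ∈ E → (v ∈ setC s n i ∨ v ∈ setD s n ∨
        v = Vtx.b n i) ∨ v ∈ Z ∨ v ∈ Q := fun u hu v huv =>
      (hE u (setC_subset_verts hn hi hu) v huv).imp_left (edges_from_setC hn hu)
    have eV : ∀ u ∈ verts s t (n - s n - 1), ∀ v, (u, v) ∈ E →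
        ((u, v) ∈ edges s t (n - s n - 1) ∨ v ∈ setA s n ∨ v ∈ setB t n) ∨ v ∈ Z ∨ v ∈ Q :=
      fun u hu v huv =>
        (hE u (verts_subset_verts hn hu) v huv).imp_left (edges_from_verts hn hu)
    have hbN : (insert (Vtx.b n i) (Z ∪ (setM s n ∪ setD s n))).card ≤ k :=
      (Finset.card_insert_le _ _).trans (by rw [← setN]; omega)
    have hbC : (insert (Vtx.b n i) (Z ∪ setD s n ∪ setC s n i)).card ≤ k := by
      have h0 := Finset.card_insert_le (Vtx.b n i) (Z ∪ setD s n ∪ setC s n i)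
      have h1 := Finset.card_union_le (Z ∪ setD s n) (setC s n i)
      have h2 := Finset.card_union_le Z (setD s n)
      rw [card_setC] at h1
      rw [card_setD] at h2
      omega
    have hbMA : (insert (Vtx.b n i) (Z ∪ setM s n ∪ setA s n)).card ≤ k := by
      have h0 := Finset.card_insert_le (Vtx.b n i) (Z ∪ setM s n ∪ setA s n)
      have h1 := Finset.card_union_le (Z ∪ setM s n) (setA s n)
      have h2 := Finset.card_union_le Z (setM s n)
      rw [card_setA] at h1
      rw [card_setM] at h2
      omega
    have hbA : (insert (Vtx.b n i) (Z ∪ setA s n)).card + (n - s n - 1) + 1 ≤ k := by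
      have h1 := Finset.card_union_le Z (setA s n)
      have h2 := Finset.card_insert_le (Vtx.b n i) (Z ∪ setA s n)
      rw [card_setA] at h1
      omega
    refine win_of_guard pZ pQ pM pD pA pB pC pV hb hQE eA eB eC ?_ hbN hbC hbMA hQW ?_
    · intro u hu v huv
      rcases eV u hu v huv with (h | h) | h
      · exact .inl (.inl (mem_verts_of_mem_edges h).2)
      · exact .inl (.inr h)
      · exact .inr h
    -- In `G_{n'}` the guard is `Z ∪ A ∪ {b_i}`, and the rest of `B` joins the side territory `Q`.
    -- The cops still on `M` are surplus, which the quantifier over `X` allows.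
    refine ih (n - s n - 1) (by omega) (Z := insert (Vtx.b n i) (Z ∪ setA s n)) ?_ ?_ ?_ ?_ ?_
      (fun X hX hXQ => win_of_subset_setB pQ pB hb hQE eB (by omega) hQW hX hXQ)
      hbA _ ?_ ?_ <;> clear ih hQW <;>
      try simp only [Set.mem_ofPred_eq, Finset.mem_insert, Finset.mem_union]
    · grind
    · grind
    · grind
    · grind
    · grind
    · grind
    · grind

lemma dagWidth_graph (hs : ∀ n : ℕ, 5 ≤ n → 2 ≤ s n ∧ (s n : ℝ) < (n : ℝ) / Real.log n)
    (ht : ∀ n : ℕ, 5 ≤ n → 2 ≤ t n) {n : ℕ} (hn : 5 ≤ n) :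
    dagWidth (graph s t n) = n + 1 := by
  have hwin : Win ⟨fun u v => (u, v) ∈ edges s t n⟩ (n + 1) ∅
      {v | v ∈ verts s t n ∨ v ∈ (∅ : Set Vtx)} := by
    refine win_verts (Z := ∅) (fun n hn => three_mul_lt hs hn)
      (fun n hn => by have := ht n hn; omega) (by simp) (by simp) (by simp)
      (fun u _ v h => .inl h) (by simp) ?_ (by simp) ∅ (by simp) (by simp)
    intro X _ _
    exact Win.move ∅ (by simp) (by simp) (by simp) (by simp) (by simp)
  have hwin' := hwin.comap (fun v => v ∈ verts s t n)
  have huniv : (Subtype.val ⁻¹' {v | v ∈ verts s t n ∨ v ∈ (∅ : Set Vtx)} :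
      Set {v // v ∈ verts s t n}) = Set.univ := by
    ext v
    simp
  rw [huniv] at hwin'
  obtain ⟨𝒟, h𝒟⟩ := Win.exists_dagDecomposition (G := graph s t n) hwin'
  have hmem : 𝒟.width ∈ {w | ∃ 𝒟 : DAGDecomposition (graph s t n), 𝒟.width = w} := ⟨𝒟, rfl⟩
  refine le_antisymm ((Nat.sInf_le hmem).trans h𝒟) (le_csInf ⟨_, hmem⟩ ?_)
  rintro w ⟨𝒟', rfl⟩
  exact 𝒟'.le_width hs ht hn

end Strategy


/-! ### The size of `G_n` and the number of levels -/

section Counting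

variable {s t : ℕ → ℕ}

/-- A level adds at most `3nT` vertices and the next level is at most `n - 1`, so all levels
together add at most `3n²T`; the `1` is the vertex `bot`. -/
lemma card_verts_le (hs : ∀ n : ℕ, 5 ≤ n → s n ≤ n) {T : ℕ} (hT : 1 ≤ T) :
    ∀ {n : ℕ}, (∀ ℓ, 5 ≤ ℓ → ℓ ≤ n → t ℓ ≤ T) → (verts s t n).card ≤ 1 + 3 * n ^ 2 * T := by
  intro n
  induction n using Nat.strong_induction_on with
  | _ n ih =>
    intro ht
    rcases lt_or_ge n 5 with hn | hn
    · rw [verts_of_lt hn, Finset.card_singleton]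
      omega
    have hsn := hs n hn
    have h0 := ih (n - s n - 1) (by omega) fun ℓ h1 h2 => ht ℓ h1 (by omega)
    have hC : ((Finset.range (t n)).biUnion (setC s n)).card ≤ t n * (n - s n) := by
      refine Finset.card_biUnion_le.trans ?_
      simp [card_setC]
    have h1 : (verts s t n).card ≤
        (verts s t (n - s n - 1)).card + s n + t n + t n * (n - s n) + n := by
      rw [verts_eq hn]
      have h2 := Finset.card_union_le (verts s t (n - s n - 1) ∪ setA s n ∪ setB t n ∪
        (Finset.range (t n)).biUnion (setC s n)) (setN s n)
      have h3 := Finset.card_union_le (verts s t (n - s n - 1) ∪ setA s n ∪ setB t n)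
        ((Finset.range (t n)).biUnion (setC s n))
      have h4 := Finset.card_union_le (verts s t (n - s n - 1) ∪ setA s n) (setB t n)
      have h5 := Finset.card_union_le (verts s t (n - s n - 1)) (setA s n)
      rw [card_setN hsn] at h2
      rw [card_setB] at h4
      rw [card_setA] at h5
      omega
    have htn := ht n hn le_rfl
    have h2 : s n + t n + t n * (n - s n) + n ≤ 3 * n * T := by
      have h3 : t n * (n - s n) ≤ T * (n - s n) := Nat.mul_le_mul_right _ htn
      have h4 : s n ≤ T * s n := Nat.le_mul_of_pos_left _ hT
      have h5 : n ≤ T * n := Nat.le_mul_of_pos_left _ hT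
      have h6 : T * s n + T * (n - s n) = T * n := by
        rw [← mul_add]
        congr 1
        omega
      have h7 : T ≤ T * n := Nat.le_mul_of_pos_right _ (by omega)
      have h8 : 3 * n * T = T * n + T * n + T * n := by ring
      omega
    have h3 : 3 * (n - s n - 1) ^ 2 + 3 * n ≤ 3 * n ^ 2 := by
      have h4 : n - s n - 1 ≤ n - 1 := by omega
      obtain ⟨m, rfl⟩ : ∃ m, n = m + 1 := ⟨n - 1, by omega⟩
      have h5 := Nat.pow_le_pow_left h4 2
      rw [Nat.add_sub_cancel] at h5
      nlinarith
    have h4 : 3 * (n - s n - 1) ^ 2 * T + 3 * n * T ≤ 3 * n ^ 2 * T := by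
      rw [← add_mul]
      exact Nat.mul_le_mul_right _ h3
    omega

lemma card_verts_isBigO (hs : ∀ n : ℕ, 5 ≤ n → s n ≤ n) (ht : ∀ n : ℕ, 5 ≤ n → 2 ≤ t n)
    (hmono : MonotoneOn t (Set.Ici 5) ∨ AntitoneOn t (Set.Ici 5)) :
    (fun n : ℕ => ((verts s t n).card : ℝ)) =O[atTop] (fun n : ℕ => (n : ℝ) ^ 2 * (t n : ℝ)) := by
  have h5 := ht 5 le_rfl
  refine Asymptotics.IsBigO.of_bound (4 * t 5) ?_
  filter_upwards [eventually_ge_atTop 5] with n hn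
  rw [Real.norm_natCast, Real.norm_of_nonneg (by positivity)]
  have htn := ht n hn
  -- The product `t 5 * t n` bounds `t` on `[5, n]` in both monotone cases.
  have h1 : (verts s t n).card ≤ 1 + 3 * n ^ 2 * (t 5 * t n) := by
    rcases hmono with h | h
    · refine card_verts_le hs (Nat.mul_pos (by omega) (by omega)) fun ℓ hℓ hℓn => ?_
      exact (h hℓ (hℓ.trans hℓn) hℓn).trans (Nat.le_mul_of_pos_left _ (by omega))
    · refine card_verts_le hs (Nat.mul_pos (by omega) (by omega)) fun ℓ hℓ hℓn => ?_
      exact (h (Set.mem_Ici.2 le_rfl) hℓ hℓ).trans (Nat.le_mul_of_pos_right _ (by omega))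
  have h2 : 1 ≤ n ^ 2 * (t 5 * t n) := Nat.mul_pos (by positivity)
    (Nat.mul_pos (by omega) (by omega))
  have h3 : (verts s t n).card ≤ 4 * t 5 * (n ^ 2 * t n) := by nlinarith
  exact_mod_cast h3

/-- A lower bound on the number of levels, from a threshold for the next level. -/
lemma succ_le_card_levels {k a b : ℕ} (h : ∀ n, a ≤ n → k ≤ (levels s n).card) (hb : 5 ≤ b)
    (hab : ∀ n, b ≤ n → a ≤ n - s n - 1) : ∀ n, b ≤ n → k + 1 ≤ (levels s n).card := by
  intro n hn
  rw [card_levels (hb.trans hn)]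
  exact Nat.succ_le_succ (h _ (hab n hn))

/-- The thresholds `5, 10, 17, 25, 35, 48, 64` are spaced so that one descent from a threshold or
above lands at the previous one or above; `p / q` is a rational lower bound for the logarithm at
each of them. -/
lemma seven_le_card_levels
    (hs : ∀ n : ℕ, 5 ≤ n → 2 ≤ s n ∧ (s n : ℝ) < (n : ℝ) / Real.log n) {n : ℕ} (hn : 64 ≤ n) :
    7 ≤ (levels s n).card := by
  have h5 : ∀ n, 5 ≤ n → 1 ≤ (levels s n).card := fun n hn => by
    rw [card_levels hn]
    omega
  have h10 := succ_le_card_levels (b := 10) h5 (by omega) fun n hn => by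
    have := mul_lt_mul_of_exp_le hs (p := 2) (q := 1) (m := 10) (by norm_num) hn one_pos
      (by norm_num)
    omega
  have h17 := succ_le_card_levels (b := 17) h10 (by omega) fun n hn => by
    have := mul_lt_mul_of_exp_le hs (p := 5) (q := 2) (m := 17) (by norm_num) hn two_pos
      (by norm_num)
    omega
  have h25 := succ_le_card_levels (b := 25) h17 (by omega) fun n hn => by
    have := mul_lt_mul_of_exp_le hs (p := 25) (q := 8) (m := 25) (by norm_num) hn (by norm_num)
      (by norm_num)
    omega
  have h35 := succ_le_card_levels (b := 35) h25 (by omega) fun n hn => by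
    have := mul_lt_mul_of_exp_le hs (p := 7) (q := 2) (m := 35) (by norm_num) hn two_pos
      (by norm_num)
    omega
  have h48 := succ_le_card_levels (b := 48) h35 (by omega) fun n hn => by
    have := mul_lt_mul_of_exp_le hs (p := 15) (q := 4) (m := 48) (by norm_num) hn (by norm_num)
      (by norm_num)
    omega
  have h64 := succ_le_card_levels (b := 64) h48 (by omega) fun n hn => by
    have := mul_lt_mul_of_exp_le hs (p := 4) (q := 1) (m := 64) (by norm_num) hn one_pos
      (by norm_num)
    omega
  exact h64 n hn

/-- Beyond `64` one has `s n < n / 4`, so a descent keeps at least half of `n`. The seven levels at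
`2 ^ 6` supply the `+ 1` that absorbs the rounding of `log₂ n`. -/
lemma lt_card_levels_of_two_pow_le
    (hs : ∀ n : ℕ, 5 ≤ n → 2 ≤ s n ∧ (s n : ℝ) < (n : ℝ) / Real.log n) {k : ℕ} (hk : 6 ≤ k) :
    ∀ n, 2 ^ k ≤ n → k + 1 ≤ (levels s n).card := by
  induction k, hk using Nat.le_induction with
  | base => exact fun n hn => seven_le_card_levels hs hn
  | succ k hk ih =>
    have hk' : 2 ^ 6 ≤ 2 ^ k := Nat.pow_le_pow_right two_pos hk
    refine succ_le_card_levels ih (by omega) fun n hn => ?_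
    have := mul_lt_mul_of_exp_le hs (n := n) (p := 4) (q := 1) (m := 64) (by norm_num) (by omega)
      one_pos (by norm_num)
    omega

lemma logb_le_card_levels
    (hs : ∀ n : ℕ, 5 ≤ n → 2 ≤ s n ∧ (s n : ℝ) < (n : ℝ) / Real.log n) {n : ℕ} (hn : 64 ≤ n) :
    Real.logb 2 n ≤ (levels s n).card := by
  have h6 : 6 ≤ Nat.log 2 n := Nat.le_log_of_pow_le (by norm_num) hn
  have h1 := lt_card_levels_of_two_pow_le hs h6 n (Nat.pow_log_le_self 2 (by omega))
  have h2 : n < 2 ^ (Nat.log 2 n + 1) := Nat.lt_pow_succ_log_self (by norm_num) n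
  have h3 : n ≤ 2 ^ (levels s n).card := h2.le.trans (Nat.pow_le_pow_right two_pos h1)
  rw [Real.logb_le_iff_le_rpow (by norm_num) (by exact_mod_cast (by omega : 0 < n)),
    Real.rpow_natCast]
  exact_mod_cast h3

lemma rpow_logb_le_prod
    (hs : ∀ n : ℕ, 5 ≤ n → 2 ≤ s n ∧ (s n : ℝ) < (n : ℝ) / Real.log n) {n : ℕ} (hn : 64 ≤ n)
    {τ : ℕ} (hτ : ∀ ℓ ∈ levels s n, τ ≤ t ℓ) :
    (τ : ℝ) ^ Real.logb 2 n ≤ ((∏ ℓ ∈ levels s n, t ℓ : ℕ) : ℝ) := by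
  have hn' : (1 : ℝ) < n := by exact_mod_cast (by omega : 1 < n)
  -- Monotonicity of the power in the exponent needs `τ ≥ 1`.
  rcases Nat.eq_zero_or_pos τ with rfl | hpos
  · rw [Nat.cast_zero, Real.zero_rpow (Real.logb_pos (by norm_num) hn').ne']
    positivity
  · calc (τ : ℝ) ^ Real.logb 2 n ≤ (τ : ℝ) ^ ((levels s n).card : ℝ) :=
          Real.rpow_le_rpow_of_exponent_le (by exact_mod_cast hpos) (logb_le_card_levels hs hn)
      _ = ((τ ^ (levels s n).card : ℕ) : ℝ) := by rw [Real.rpow_natCast, Nat.cast_pow]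
      _ ≤ _ := by exact_mod_cast Finset.pow_card_le_prod _ _ _ hτ

/-- The number of levels grows faster than any multiple of the logarithm. -/
lemma exists_pow_le_mul_two_pow_card_levels
    (hs : ∀ n : ℕ, 5 ≤ n → 2 ≤ s n ∧ (s n : ℝ) < (n : ℝ) / Real.log n) (q : ℕ) :
    ∃ K : ℕ, ∀ n, n ^ q ≤ K * 2 ^ (levels s n).card := by
  have hlog : Tendsto (fun n : ℕ => Real.log n) atTop atTop :=
    Real.tendsto_log_atTop.comp tendsto_natCast_atTop_atTop
  -- The `+ 1` keeps the logarithm positive even for `q = 0`.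
  obtain ⟨N, hN⟩ := eventually_atTop.1 (hlog.eventually_ge_atTop (4 * q + 1))
  let N' := max N (max 5 (4 * q))
  refine ⟨N' ^ q, fun n => ?_⟩
  induction n using Nat.strong_induction_on with
  | _ n ih =>
    rcases lt_or_ge n N' with hn | hn
    · calc n ^ q ≤ N' ^ q := Nat.pow_le_pow_left hn.le q
        _ ≤ _ := Nat.le_mul_of_pos_right _ (by positivity)
    have hn1 : N ≤ n := (le_max_left _ _).trans hn
    have hn2 : 5 ≤ n := ((le_max_left _ _).trans (le_max_right _ _)).trans hn
    have hn3 : 4 * q ≤ n := ((le_max_right _ _).trans (le_max_right _ _)).trans hn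
    have hsn := three_mul_lt hs hn2
    have hn0 : (0 : ℝ) < n := by exact_mod_cast (by omega : 0 < n)
    have hs4 : 4 * q * s n ≤ n := by
      have h1 := hN n hn1
      have h2 := (lt_div_iff₀ (by linarith [q.cast_nonneg (α := ℝ)])).1 (hs n hn2).2
      have h3 : (4 * q : ℝ) * s n ≤ n := by
        calc (4 * q : ℝ) * s n ≤ Real.log n * s n := by gcongr; linarith
          _ ≤ n := by linarith
      exact_mod_cast h3
    -- By Bernoulli a descent at most halves `n ^ q`, since `q * s n` and `q` are each at most `n /
    -- 4`.
    have hpow : n ^ q ≤ 2 * (n - s n - 1) ^ q := by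
      have hcast : ((n - s n - 1 : ℕ) : ℝ) = n * (1 + -((s n + 1) / n)) := by
        rw [Nat.cast_sub (by omega), Nat.cast_sub (by omega)]
        field_simp
        push_cast
        ring
      have hq : (q : ℝ) * ((s n + 1) / n) ≤ 1 / 2 := by
        rw [← mul_div_assoc, div_le_iff₀ hn0]
        have h1 : (4 * q * s n : ℝ) ≤ n := by exact_mod_cast hs4
        have h2 : (4 * q : ℝ) ≤ n := by exact_mod_cast hn3
        linarith
      have hle : ((s n + 1 : ℝ)) / n ≤ 1 := by
        rw [div_le_one hn0]
        exact_mod_cast (by omega : s n + 1 ≤ n)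
      have hbern := one_add_mul_le_pow (a := -((s n + 1 : ℝ) / n)) (by linarith) q
      have : (n : ℝ) ^ q ≤ 2 * ((n - s n - 1 : ℕ) : ℝ) ^ q := by
        rw [hcast, mul_pow]
        have h3 : (1 / 2 : ℝ) ≤ (1 + -((s n + 1) / n)) ^ q := by linarith
        have h4 : (0 : ℝ) ≤ (n : ℝ) ^ q := by positivity
        nlinarith
      exact_mod_cast this
    calc n ^ q ≤ 2 * (n - s n - 1) ^ q := hpow
      _ ≤ 2 * (N' ^ q * 2 ^ (levels s (n - s n - 1)).card) := by
        gcongr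
        exact ih _ (by omega)
      _ = N' ^ q * 2 ^ (levels s n).card := by
        rw [card_levels hn2, pow_succ]
        ring

lemma exists_card_verts_le_pow (hs : ∀ n : ℕ, 5 ≤ n → s n ≤ n)
    (ht : ∃ k : ℕ, ∀ᶠ n : ℕ in atTop, t n ≤ n ^ k) :
    ∃ K : ℕ, ∀ᶠ n : ℕ in atTop, (verts s t n).card ≤ n ^ K := by
  obtain ⟨k, hk⟩ := ht
  obtain ⟨N, hN⟩ := eventually_atTop.1 hk
  let C := (Finset.range N).sup t
  refine ⟨k + 4, ?_⟩
  filter_upwards [eventually_ge_atTop (4 * (C + 1)), eventually_ge_atTop 1] with n hn hn1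
  have hpos : 1 ≤ n ^ k := Nat.one_le_pow _ _ hn1
  have hT : ∀ ℓ, 5 ≤ ℓ → ℓ ≤ n → t ℓ ≤ (C + 1) * n ^ k := by
    intro ℓ _ hℓ
    rcases lt_or_ge ℓ N with h | h
    · calc t ℓ ≤ C := Finset.le_sup (Finset.mem_range.2 h)
        _ ≤ (C + 1) * 1 := by omega
        _ ≤ _ := Nat.mul_le_mul_left _ hpos
    · calc t ℓ ≤ ℓ ^ k := hN ℓ h
        _ ≤ n ^ k := Nat.pow_le_pow_left hℓ k
        _ ≤ _ := Nat.le_mul_of_pos_left _ (by omega)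
  have h1 := card_verts_le hs (t := t) (T := (C + 1) * n ^ k) (Nat.mul_pos (by omega) hpos) hT
  have h2 : 1 ≤ n ^ 2 * ((C + 1) * n ^ k) :=
    Nat.mul_pos (Nat.pow_pos hn1) (Nat.mul_pos (by omega) hpos)
  calc (verts s t n).card ≤ 4 * (C + 1) * (n ^ 2 * n ^ k) := by linarith
    _ ≤ (n * n) * (n ^ 2 * n ^ k) := Nat.mul_le_mul_right _ (hn.trans (Nat.le_mul_of_pos_left _ hn1))
    _ = n ^ (k + 4) := by ring

/-- If `|G_n| ≤ n ^ K`, then the growth bound with exponent `K * c + 1` has one factor `n` to spare,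
which beats its constant. -/
lemma eventually_card_verts_pow_lt
    (hs : ∀ n : ℕ, 5 ≤ n → 2 ≤ s n ∧ (s n : ℝ) < (n : ℝ) / Real.log n)
    (ht : ∃ k : ℕ, ∀ᶠ n : ℕ in atTop, t n ≤ n ^ k) (c : ℕ) :
    ∀ᶠ n : ℕ in atTop, (verts s t n).card ^ c < 2 ^ (levels s n).card := by
  obtain ⟨K, hK⟩ := exists_card_verts_le_pow (s := s)
    (fun n hn => by have := three_mul_lt hs hn; omega) ht
  obtain ⟨C, hC⟩ := exists_pow_le_mul_two_pow_card_levels hs (K * c + 1)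
  filter_upwards [hK, eventually_gt_atTop C] with n hn hnC
  refine (Nat.pow_le_pow_left hn c).trans_lt ?_
  rw [← pow_mul]
  by_contra! h
  have h1 : C * 2 ^ (levels s n).card < n ^ (K * c + 1) := by
    calc C * 2 ^ (levels s n).card ≤ C * n ^ (K * c) := Nat.mul_le_mul_left _ h
      _ < n * n ^ (K * c) := Nat.mul_lt_mul_of_pos_right hnC (Nat.pow_pos (by omega))
      _ = n ^ (K * c + 1) := by ring
  exact absurd (hC n) (not_le.2 h1)

end Counting

end DagWidth

theorem mainTheorem2 (s t : ℕ → ℕ)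
    (hs : ∀ n : ℕ, 5 ≤ n → 2 ≤ s n ∧ (s n : ℝ) < (n : ℝ) / Real.log n)
    (ht : ∀ n : ℕ, 5 ≤ n → 2 ≤ t n) :
    -- the optimal width of a DAG decomposition is `n + 1`
    (∀ n : ℕ, 5 ≤ n → DagWidth.dagWidth (DagWidth.graph s t n) = n + 1) ∧
    -- the number of vertices is `O(n² t(n))`
    ((MonotoneOn t (Set.Ici 5) ∨ AntitoneOn t (Set.Ici 5)) →
      (fun n : ℕ => ((DagWidth.verts s t n).card : ℝ))
        =O[atTop] (fun n : ℕ => (n : ℝ) ^ 2 * (t n : ℝ))) ∧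
    -- the number of bags is at least the product of `t` over the levels
    (∀ n : ℕ, 5 ≤ n → ∀ 𝒟 : DagWidth.DAGDecomposition (DagWidth.graph s t n),
      𝒟.width = n + 1 → ∏ ℓ ∈ DagWidth.levels s n, t ℓ ≤ 𝒟.numBags) ∧
    -- hence at least `τ ^ log n`, where `τ` is the minimum of `t` over the levels
    (∀ n : ℕ, 64 ≤ n → ∀ τ : ℕ, (∀ ℓ ∈ DagWidth.levels s n, τ ≤ t ℓ) →
      ∀ 𝒟 : DagWidth.DAGDecomposition (DagWidth.graph s t n),
        𝒟.width = n + 1 → (τ : ℝ) ^ Real.logb 2 n ≤ (𝒟.numBags : ℝ)) ∧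
    -- the number of bags is super-polynomial in the size of the graph
    ((∃ k : ℕ, ∀ᶠ n : ℕ in atTop, t n ≤ n ^ k) →
      ∀ c : ℕ, ∀ᶠ n : ℕ in atTop,
        ∀ 𝒟 : DagWidth.DAGDecomposition (DagWidth.graph s t n),
          𝒟.width = n + 1 → (DagWidth.verts s t n).card ^ c < 𝒟.numBags) := by
  have hsn : ∀ n : ℕ, 5 ≤ n → s n ≤ n := fun n hn => by
    have := DagWidth.three_mul_lt hs hn
    omega
  refine ⟨fun n hn => DagWidth.dagWidth_graph hs ht hn, DagWidth.card_verts_isBigO hsn ht,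
    fun n hn 𝒟 hw => 𝒟.prod_le_numBags hs ht hn hw, fun n hn τ hτ 𝒟 hw => ?_, fun hk c => ?_⟩
  · refine (DagWidth.rpow_logb_le_prod hs hn hτ).trans ?_
    exact_mod_cast 𝒟.prod_le_numBags hs ht (by omega) hw
  · filter_upwards [DagWidth.eventually_card_verts_pow_lt hs hk c, eventually_ge_atTop 5]
      with n hn hn5 𝒟 hw
    refine hn.trans_le (le_trans ?_ (𝒟.prod_le_numBags hs ht hn5 hw))
    exact Finset.pow_card_le_prod _ _ _ fun ℓ hℓ => ht ℓ (DagWidth.le_of_mem_levels hℓ).1
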